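/- **Setting.** Let $0=x_0<x_1<\dots<x_n=1$ and $0=q_0<q_1<\dots<q_n=1$, and let $\varrho=\sum_{k=1}^n q_k\mathbf 1_{[x_k,x_{k+1})}$ on $[0,1]$ (the last interval being $\{1\}$). Let $N$ run through a strictly increasing sequence of positive integers with $x_kN\in\mathbb N$ for all $k$. For $\sigma,\tau\in\Sigma_N=\{-1,1\}^N$ let $q_{\mathrm L}(\sigma,\tau)$ be $1/N$ times the length of the longest common initial segment of $\sigma$ and $\tau$. For each such $N$ let $(Y_N(\sigma))_{\sigma\in\Sigma_N}$ be a centered Gaussian process with covariance $\mathbb E[Y_N(\sigma)Y_N(\tau)]=\varrho(q_{\mathrm L}(\sigma,\tau))$, all defined on one probability space (with arbitrary joint law for different $N$). For $\beta>0$, $h\ge 0$ put $$X_N(h,\sigma)=Y_N(\sigma)+\frac{h}{\sqrt N}\sum_{i=1}^N\sigma_i,\qquad p_N(\beta,h)=\frac1N\log\sum_{\sigma\in\Sigma_N}e^{\beta\sqrt N X_N(h,\sigma)} .$$ Let $I(t)=\frac12[(1-t)\log(1-t)+(1+t)\log(1+t)]$ and $\rho(t)=\sqrt{2(\log 2-I(t))}$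 for $t\in[-1,1]$, and let $t_*(h)$ be the unique maximizer of $t\mapsto\rho(t)+ht$ on $[-1,1]$. For $1\le j\le k\le n$ let $$\theta_{j,k}=\frac{q_k-q_{j-1}}{x_k-x_{j-1}},\qquad \widetilde\theta_{j,k}=\theta_{j,k}\,\rho\bigl(t_*(\theta_{j,k}^{-1/2}h)\bigr)^{-2}.$$ Define $J_0=0$ and, as long as $J_{l-1}<n$, $$J_l=\min\bigl\{J\in\{J_{l-1}+1,\dots,n\}:\ \widetilde\theta_{J_{l-1}+1,J}>\widetilde\theta_{J+1,k}\ \text{for all } J<k\le n\bigr\};$$ let $m$ be the index with $J_m=n$. For $1\le l\le m$ put $\bar q_l=q_{J_l}-q_{J_{l-1}}$, $\bar x_l=x_{J_l}-x_{J_{l-1}}$, $\bar\theta_l=\theta_{J_{l-1}+1,J_l}=\bar q_l/\bar x_l$, $\bar\gamma_l=\widetilde\theta_{J_{l-1}+1,J_l}^{1/2}$. Let $l(\beta,h)$ be the largest $l\in\{1,\dots,m\}$ with $\beta\bar\gamma_l>1$, and $0$ if there is none. **Theorem.** Along the given sequence of $N$, almost surely and in $L^1$, $$\lim_{N\to\infty}p_N(\beta,h)=\beta\sum_{l=1}^{l(\beta,h)}\Bigl[(\bar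 x_l\bar q_l)^{1/2}\rho\bigl(t_*(\bar\theta_l^{-1/2}h)\bigr)+h\,\bar x_l\,t_*(\bar\theta_l^{-1/2}h)\Bigr]+\bigl(1-x_{J_{l(\beta,h)}}\bigr)\bigl(\log 2+\log\cosh(\beta h)\bigr)+\tfrac12\beta^2\bigl(1-q_{J_{l(\beta,h)}}\bigr).$$ -/

import Mathlib

open MeasureTheory ProbabilityTheory Filter Topology

noncomputable section

namespace GREM

/-! ### The model -/

/-- The discrete hypercube `{-1, 1}^N`. -/
abbrev Config (N : ℕ) : Type := Fin N → ℤˣ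

/-- The value of the `i`-th spin as a real number. -/
def spin {N : ℕ} (σ : Config N) (i : Fin N) : ℝ := ((σ i : ℤ) : ℝ)

/-- The length of the longest common initial segment of `σ` and `τ`
(it is `0` if the first coordinates differ). -/
def commonPrefix {N : ℕ} (σ τ : Config N) : ℕ :=
  Nat.findGreatest (fun k => ∀ i : Fin N, i.val < k → σ i = τ i) N

/-- The normalized lexicographic overlap. -/
def lexOverlap {N : ℕ} (σ τ : Config N) : ℝ := (commonPrefix σ τ : ℝ) / (N : ℝ)

/-- The parameters `0 = x_0 < x_1 < ⋯ < x_n = 1` and `0 = q_0 < q_1 < ⋯ < q_n = 1` of a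
discrete order parameter with `n` jumps. Only the values at indices `0, …, n` are ever used. -/
structure OrderParameter (n : ℕ) where
  x : ℕ → ℝ
  q : ℕ → ℝ
  x_zero : x 0 = 0
  x_last : x n = 1
  x_lt : ∀ k < n, x k < x (k + 1)
  q_zero : q 0 = 0
  q_last : q n = 1
  q_lt : ∀ k < n, q k < q (k + 1)

namespace OrderParameter

variable {n : ℕ} (r : OrderParameter n)

/-- The interval on which the step function takes the value `q_k`:
`[x_k, x_{k+1})` for `k < n`, and everything from `x_n = 1` on for `k = n`. -/
def stepSet (k : ℕ) : Set ℝ :=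
  if k < n then Set.Ico (r.x k) (r.x (k + 1)) else Set.Ici (r.x k)

/-- The step function `ϱ(y) = ∑_{k=1}^n q_k 1_{[x_k, x_{k+1})}(y)`. -/
def toFun (y : ℝ) : ℝ :=
  ∑ k ∈ Finset.Icc 1 n, (r.stepSet k).indicator (fun _ => r.q k) y

end OrderParameter

/-- `Y` is (a version of) the GREM process on `{-1, 1}^N` with order parameter `r`:
a centered Gaussian process with covariance `ϱ(q_L(σ, τ))`. -/
structure IsGREM {n : ℕ} (r : OrderParameter n) (N : ℕ) {Ω : Type*} [MeasurableSpace Ω]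
    (P : Measure Ω) (Y : Config N → Ω → ℝ) : Prop where
  gaussian : IsGaussianProcess Y P
  centered : ∀ σ, ∫ ω, Y σ ω ∂P = 0
  covariance : ∀ σ τ, ∫ ω, Y σ ω * Y τ ω ∂P = r.toFun (lexOverlap σ τ)

/-- The Hamiltonian with external field, `X_N(h, σ) = Y(σ) + (h / √N) ∑ σ_i`,
for a fixed realization `y` of the process. -/
def hamiltonian {N : ℕ} (h : ℝ) (y : Config N → ℝ) (σ : Config N) : ℝ :=
  y σ + h / √(N : ℝ) * ∑ i, spin σ i

/-- The partition function `Z_N(β, h)`. -/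
def partitionFunction {N : ℕ} (β h : ℝ) (y : Config N → ℝ) : ℝ :=
  ∑ σ : Config N, Real.exp (β * √(N : ℝ) * hamiltonian h y σ)

/-- The free energy `p_N(β, h) = N⁻¹ log Z_N(β, h)`. -/
def freeEnergy {N : ℕ} (β h : ℝ) (y : Config N → ℝ) : ℝ :=
  1 / (N : ℝ) * Real.log (partitionFunction β h y)

/-! ### The functions `I`, `ρ` and `t_*` -/

/-- Cramér's entropy function. -/
def cramerEntropy (t : ℝ) : ℝ :=
  1 / 2 * ((1 - t) * Real.log (1 - t) + (1 + t) * Real.log (1 + t))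

/-- `ρ(t) = √(2 (log 2 - I(t)))`. -/
def rho (t : ℝ) : ℝ := √(2 * (Real.log 2 - cramerEntropy t))

theorem continuous_rho : Continuous rho := by
  unfold rho cramerEntropy
  have h1 : Continuous fun t : ℝ => (1 - t) * Real.log (1 - t) :=
    Real.continuous_mul_log.comp (continuous_const.sub continuous_id)
  have h2 : Continuous fun t : ℝ => (1 + t) * Real.log (1 + t) :=
    Real.continuous_mul_log.comp (continuous_const.add continuous_id)
  fun_prop

theorem exists_isMaxOn_rho_add (h : ℝ) :
    ∃ t ∈ Set.Icc (-1 : ℝ) 1, IsMaxOn (fun s => rho s + h * s) (Set.Icc (-1) 1) t :=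
  isCompact_Icc.exists_isMaxOn ⟨0, by norm_num⟩
    (continuous_rho.add (continuous_const.mul continuous_id)).continuousOn

/-- `t_*(h)`: the maximizer of `t ↦ ρ(t) + h t` over `[-1, 1]`
(it is unique, since the function is strictly concave there). -/
def tStar (h : ℝ) : ℝ := (exists_isMaxOn_rho_add h).choose

/-! ### Slopes and coarse-graining -/

namespace OrderParameter

variable {n : ℕ} (r : OrderParameter n)

/-- The slope `θ_{j,k} = (q_k - q_{j-1}) / (x_k - x_{j-1})`, for `1 ≤ j ≤ k ≤ n`. -/
def slope (j k : ℕ) : ℝ := (r.q k - r.q (j - 1)) / (r.x k - r.x (j - 1))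

/-- The modified slope `θ̃_{j,k}(h) = θ_{j,k} ρ(t_*(θ_{j,k}^{-1/2} h))^{-2}`. -/
def modSlope (h : ℝ) (j k : ℕ) : ℝ :=
  r.slope j k / rho (tStar (h / √(r.slope j k))) ^ 2

/-- The coarse-graining indices: `J_0 = 0` and, as long as `J_{l-1} < n`, `J_l` is the least
`J ∈ (J_{l-1}, n]` with `θ̃_{J_{l-1}+1, J} > θ̃_{J+1, k}` for all `k ∈ (J, n]`; the index `J = n`
always qualifies. After `n` has been reached, the sequence is continued by the constant `n`. -/
def J (h : ℝ) : ℕ → ℕ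
  | 0 => 0
  | l + 1 =>
    if J h l < n then
      sInf {j : ℕ | J h l < j ∧ j ≤ n ∧
        ∀ k, j < k → k ≤ n → r.modSlope h (j + 1) k < r.modSlope h (J h l + 1) j}
    else n

/-- The number `m(h)` of coarse-grained levels: the first `l` with `J_l = n`. -/
def m (h : ℝ) : ℕ := sInf {l : ℕ | r.J h l = n}

/-- `q̄_l = q_{J_l} - q_{J_{l-1}}`. -/
def qBar (h : ℝ) (l : ℕ) : ℝ := r.q (r.J h l) - r.q (r.J h (l - 1))

/-- `x̄_l = x_{J_l} - x_{J_{l-1}}`. -/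
def xBar (h : ℝ) (l : ℕ) : ℝ := r.x (r.J h l) - r.x (r.J h (l - 1))

/-- `θ̄_l = θ_{J_{l-1}+1, J_l}`, which equals `q̄_l / x̄_l`. -/
def thetaBar (h : ℝ) (l : ℕ) : ℝ := r.slope (r.J h (l - 1) + 1) (r.J h l)

/-- `γ̄_l = (θ̃_{J_{l-1}+1, J_l})^{1/2}`. -/
def gammaBar (h : ℝ) (l : ℕ) : ℝ := √(r.modSlope h (r.J h (l - 1) + 1) (r.J h l))

open Classical in
/-- `l(β, h)`: the greatest `l ∈ [1, m(h)]` with `β γ̄_l > 1`, and `0` if there is none. -/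
def frozenLevel (β h : ℝ) : ℕ :=
  ((Finset.Icc 1 (r.m h)).filter (fun l => 1 < β * r.gammaBar h l)).sup id

/-- The limiting free energy. -/
def limitFreeEnergy (β h : ℝ) : ℝ :=
  β * ∑ l ∈ Finset.Icc 1 (r.frozenLevel β h),
      (√(r.xBar h l * r.qBar h l) * rho (tStar (h / √(r.thetaBar h l)))
        + h * r.xBar h l * tStar (h / √(r.thetaBar h l)))
    + (1 - r.x (r.J h (r.frozenLevel β h))) * (Real.log 2 + Real.log (Real.cosh (β * h)))
    + 1 / 2 * β ^ 2 * (1 - r.q (r.J h (r.frozenLevel β h)))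

end OrderParameter

end GREM

end

noncomputable section

namespace GREM

/-! ### Entropy, the function `ρ` and its maximizer -/

/-! The process has the law of a Gaussian field on a tree with n levels: level k carries the spins
of the block between x_k N and x_{k+1} N, and each vertex at that level carries an independent
Gaussian of variance q_{k+1} - q_k (`IsGREM.map_eq`). Write Δx_k, Δq_k for the increments. The free
energy is bounded from above and below by two functionals of level-dependent inverse temperatures
b_k, and one choice of b makes the two values coincide.

Upper bound. For nondecreasing b_k ≤ β, take fractional moments of order m_k = b_k / β ≤ 1, working
from the leaves to the root: subadditivity of z ↦ z^m at each branching, Lyapunov's inequality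
between levels (`lintegral_subtreePartition_rpow_le`). This gives E exp(m_0 N (p_N - U(b))) ≤ 1.

Lower bound. Tilt the spins of block k by b_k h, so that their mean is tanh(b_k h), and ask the
Gaussian at level k to exceed about b_k √(Δq_k N). A second moment argument
(`measure_branchMass_lt_le`) finds such branches as soon as, for every K, the entropy Σ_{k<K} Δx_k
entropy(tanh(b_k h)) is at least the cost Σ_{k<K} b_k² Δq_k / 2. The failure probability is
exponentially small (`exists_measure_freeEnergy_lt_le`).

Matching. The modified slope is a strictly increasing function of the slope (`modify_lt_modify`), so
the indices J_l trace the concave hull of the points (x_k, q_k). A hull block of slope θ has a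
critical inverse temperature c with c √θ = ρ(tanh(c h)); then t_*(θ^{-1/2} h) = tanh(c h) and γ̄ =
1/c. With b = min(β, c) on each block, the entropy constraint is tight over each frozen block and b
= β on the others; both functionals then equal the claimed limit
(`OrderParameter.exists_levelBeta`).

Since both deviation bounds are exponential in N, Borel–Cantelli gives almost sure convergence
whatever the joint law for different N. For L¹, the exponential moment controls the positive part
and the energy of the all-plus configuration controls the negative part. -/

/-- The exponential growth rate of the number of configurations with mean spin `t`. -/
def entropy (t : ℝ) : ℝ := Real.log 2 - cramerEntropy t

lemma rho_eq (t : ℝ) : rho t = √(2 * entropy t) := rfl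

/-- One term of Gibbs' inequality, from log z ≤ z - 1 at z = y/x. The case x = 0 is included so that
the magnetizations ±1 are covered later. -/
lemma sub_le_mul_log_sub_log {x y : ℝ} (hx : 0 ≤ x) (hy : 0 < y) :
    x - y ≤ x * (Real.log x - Real.log y) := by
  rcases hx.eq_or_lt with rfl | hx
  · simp [hy.le]
  · have h := Real.log_le_sub_one_of_pos (div_pos hy hx)
    rw [Real.log_div hy.ne' hx.ne'] at h
    have := mul_le_mul_of_nonneg_left h hx.le
    have h2 : x * (y / x - 1) = y - x := by field_simp
    linarith

lemma eq_of_mul_log_sub_log_le {x y : ℝ} (hx : 0 ≤ x) (hy : 0 < y)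
    (h : x * (Real.log x - Real.log y) ≤ x - y) : x = y := by
  rcases hx.eq_or_lt with rfl | hx
  · simp at h; linarith
  · by_contra hne
    have h' := Real.log_lt_sub_one_of_pos (div_pos hy hx)
      (by rw [Ne, div_eq_one_iff_eq hx.ne']; exact fun h => hne h.symm)
    rw [Real.log_div hy.ne' hx.ne'] at h'
    have := mul_lt_mul_of_pos_left h' hx
    have h2 : x * (y / x - 1) = y - x := by field_simp
    linarith

lemma log_one_add_tanh (y : ℝ) :
    Real.log (1 + Real.tanh y) = y - Real.log (Real.cosh y) := by
  have hc := Real.cosh_pos y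
  have : 1 + Real.tanh y = Real.exp y / Real.cosh y := by
    rw [Real.tanh_eq_sinh_div_cosh, ← Real.cosh_add_sinh]; field_simp
  rw [this, Real.log_div (Real.exp_pos y).ne' hc.ne', Real.log_exp]

lemma log_one_sub_tanh (y : ℝ) :
    Real.log (1 - Real.tanh y) = -y - Real.log (Real.cosh y) := by
  have := log_one_add_tanh (-y)
  rwa [Real.tanh_neg, Real.cosh_neg, ← sub_eq_add_neg] at this

lemma log_two_mul_cosh (y : ℝ) :
    Real.log (2 * Real.cosh y) = Real.log 2 + Real.log (Real.cosh y) :=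
  Real.log_mul two_ne_zero (Real.cosh_pos y).ne'

lemma entropy_tanh (y : ℝ) :
    entropy (Real.tanh y) + y * Real.tanh y = Real.log (2 * Real.cosh y) := by
  rw [entropy, cramerEntropy, log_one_add_tanh, log_one_sub_tanh, log_two_mul_cosh]; ring

/-- The gap is the relative entropy of the ±1 law of mean t with respect to the one of mean tanh y.
With `entropy_tanh` it makes y ↦ log(2 cosh y) the Legendre dual of `entropy`. -/
lemma entropy_add_mul_le {t : ℝ} (ht : t ∈ Set.Icc (-1 : ℝ) 1) (y : ℝ) :
    entropy t + y * t ≤ Real.log (2 * Real.cosh y) := by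
  have h1 := sub_le_mul_log_sub_log (x := 1 + t) (y := 1 + Real.tanh y) (by linarith [ht.1])
    (by linarith [Real.neg_one_lt_tanh y])
  have h2 := sub_le_mul_log_sub_log (x := 1 - t) (y := 1 - Real.tanh y) (by linarith [ht.2])
    (by linarith [Real.tanh_lt_one y])
  rw [log_one_add_tanh] at h1
  rw [log_one_sub_tanh] at h2
  rw [entropy, cramerEntropy, log_two_mul_cosh]
  linarith

/-- Equality case of Gibbs' inequality: the two terms of the relative entropy are nonnegative, so
both vanish, and one of them already determines t. -/
lemma eq_tanh_of_le {t y : ℝ} (ht : t ∈ Set.Icc (-1 : ℝ) 1)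
    (h : Real.log (2 * Real.cosh y) ≤ entropy t + y * t) : t = Real.tanh y := by
  have h1 := sub_le_mul_log_sub_log (x := 1 + t) (y := 1 + Real.tanh y) (by linarith [ht.1])
    (by linarith [Real.neg_one_lt_tanh y])
  have h2 := eq_of_mul_log_sub_log_le (x := 1 - t) (y := 1 - Real.tanh y) (by linarith [ht.2])
    (by linarith [Real.tanh_lt_one y])
  rw [log_one_add_tanh] at h1
  rw [log_one_sub_tanh] at h2
  rw [entropy, cramerEntropy, log_two_mul_cosh] at h
  linarith [h2 (by linarith)]

lemma tanh_mem_Icc (y : ℝ) : Real.tanh y ∈ Set.Icc (-1 : ℝ) 1 :=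
  ⟨(Real.neg_one_lt_tanh y).le, (Real.tanh_lt_one y).le⟩

lemma entropy_tanh_pos (y : ℝ) : 0 < entropy (Real.tanh y) := by
  have h2 : cramerEntropy (Real.tanh y) < Real.log 2 := by
    have h1 := Real.neg_one_lt_tanh y
    have h3 := Real.tanh_lt_one y
    have l1 : Real.log (1 - Real.tanh y) < Real.log 2 := Real.log_lt_log (by linarith) (by linarith)
    have l2 : Real.log (1 + Real.tanh y) < Real.log 2 := Real.log_lt_log (by linarith) (by linarith)
    rw [cramerEntropy]
    nlinarith
  rw [entropy]; linarith

/-- Adding the duality inequalities at y and at z gives (z - y)(tanh z - tanh y) ≥ 0, without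
derivatives. -/
lemma tanh_le_tanh {y z : ℝ} (h : y ≤ z) : Real.tanh y ≤ Real.tanh z := by
  have h1 := entropy_add_mul_le (tanh_mem_Icc y) z
  have h2 := entropy_add_mul_le (tanh_mem_Icc z) y
  rw [← entropy_tanh] at h1 h2
  rcases h.eq_or_lt with rfl | h
  · rfl
  · by_contra hc
    nlinarith

lemma entropy_tanh_le {y z : ℝ} (hy : 0 ≤ y) (h : y ≤ z) :
    entropy (Real.tanh z) ≤ entropy (Real.tanh y) := by
  have h2 := entropy_add_mul_le (tanh_mem_Icc z) y
  rw [← entropy_tanh] at h2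
  nlinarith [tanh_le_tanh h]

lemma rho_tanh_sq (y : ℝ) : rho (Real.tanh y) ^ 2 = 2 * entropy (Real.tanh y) := by
  rw [rho_eq, Real.sq_sqrt (by linarith [entropy_tanh_pos y])]

lemma rho_tanh_pos (y : ℝ) : 0 < rho (Real.tanh y) := by
  rw [rho_eq]; exact Real.sqrt_pos.2 (by linarith [entropy_tanh_pos y])

lemma rho_tanh_le {y z : ℝ} (hy : 0 ≤ y) (h : y ≤ z) :
    rho (Real.tanh z) ≤ rho (Real.tanh y) := by
  rw [rho_eq, rho_eq]
  exact Real.sqrt_le_sqrt (by linarith [entropy_tanh_le hy h])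

lemma continuous_tanh : Continuous Real.tanh := by
  have : Real.tanh = fun x => Real.sinh x / Real.cosh x := by
    ext x; exact Real.tanh_eq_sinh_div_cosh x
  rw [this]
  exact Real.continuous_sinh.div Real.continuous_cosh fun x => (Real.cosh_pos x).ne'

lemma entropy_nonneg {t : ℝ} (ht : t ∈ Set.Icc (-1 : ℝ) 1) : 0 ≤ entropy t := by
  have hl : ∀ x : ℝ, 0 ≤ x → x ≤ 2 → x * Real.log x ≤ x * Real.log 2 := by
    intro x h0 h2
    rcases h0.eq_or_lt with rfl | h0
    · simp
    · exact mul_le_mul_of_nonneg_left (Real.log_le_log h0 h2) h0.le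
  have h1 := hl (1 - t) (by linarith [ht.2]) (by linarith [ht.1])
  have h2 := hl (1 + t) (by linarith [ht.1]) (by linarith [ht.2])
  rw [entropy, cramerEntropy]
  linarith

/-- The maximizer of `t ↦ ρ(t) + (y / ρ(tanh y)) t` is `tanh y`. -/
lemma tStar_eq_tanh (y : ℝ) :
    tStar (y / rho (Real.tanh y)) = Real.tanh y := by
  set c := rho (Real.tanh y) with hc
  have hc0 : 0 < c := rho_tanh_pos y
  have hc2 : c ^ 2 = 2 * entropy (Real.tanh y) := rho_tanh_sq y
  obtain ⟨hmem, hmax⟩ := (exists_isMaxOn_rho_add (y / c)).choose_spec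
  set t := tStar (y / c) with ht
  change t ∈ _ at hmem
  have h1 : rho (Real.tanh y) + y / c * Real.tanh y ≤ rho t + y / c * t :=
    hmax (tanh_mem_Icc y)
  have h2 : rho t ^ 2 = 2 * entropy t := by
    rw [rho_eq, Real.sq_sqrt (by linarith [entropy_nonneg hmem])]
  apply eq_tanh_of_le (y := y) hmem
  rw [← entropy_tanh]
  rw [← hc] at h1
  have h3 : c * c + y * Real.tanh y ≤ c * rho t + y * t := by
    have := mul_le_mul_of_nonneg_left h1 hc0.le
    have e : ∀ s, c * (y / c * s) = y * s := fun s => by field_simp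
    rw [mul_add, mul_add, e, e] at this
    exact this
  -- Since c² and ρ(t)² are twice the entropies, 2cρ(t) ≤ c² + ρ(t)² turns optimality for ρ into
  -- optimality for `entropy`.
  nlinarith [sq_nonneg (c - rho t)]

/-- The critical inverse temperature of a block of slope `θ`. -/
lemma exists_criticalBeta {h θ : ℝ} (hh : 0 ≤ h) (hθ : 0 < θ) :
    ∃ b, 0 < b ∧ b * √θ = rho (Real.tanh (b * h)) := by
  have hs := Real.sqrt_pos.2 hθ
  have hcont : Continuous fun b : ℝ => b * √θ - rho (Real.tanh (b * h)) :=
    (continuous_id.mul continuous_const).sub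
      (continuous_rho.comp (continuous_tanh.comp (continuous_id.mul continuous_const)))
  -- The difference is negative at b = 0 and nonnegative at b = R/√θ, because ρ(tanh ·) is at most R
  -- on the nonnegative axis.
  set R := rho (Real.tanh 0)
  have hR : 0 < R := rho_tanh_pos 0
  have hB : 0 < R / √θ := div_pos hR hs
  have := intermediate_value_Icc hB.le hcont.continuousOn
  have h0 : (0 : ℝ) ∈ Set.Icc ((0 : ℝ) * √θ - rho (Real.tanh (0 * h)))
      (R / √θ * √θ - rho (Real.tanh (R / √θ * h))) := by
    constructor
    · simp only [zero_mul, zero_sub]; linarith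
    · rw [div_mul_cancel₀ _ hs.ne']
      have := rho_tanh_le (y := 0) (z := R / √θ * h) le_rfl (by positivity)
      linarith
  obtain ⟨b, hb, hb'⟩ := this h0
  have hb0 : b * √θ = rho (Real.tanh (b * h)) := by simpa [sub_eq_zero] using hb'
  refine ⟨b, ?_, hb0⟩
  have := rho_tanh_pos (b * h)
  rw [← hb0] at this
  exact pos_of_mul_pos_left this hs.le

lemma tStar_of_criticalBeta {h θ b : ℝ} (hb : 0 < b)
    (hbθ : b * √θ = rho (Real.tanh (b * h))) : tStar (h / √θ) = Real.tanh (b * h) := by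
  have := tStar_eq_tanh (b * h)
  rwa [← hbθ, mul_div_mul_left _ _ hb.ne'] at this

/-- The modified slope as a function of the slope. -/
def modify (h θ : ℝ) : ℝ := θ / rho (tStar (h / √θ)) ^ 2

lemma modify_of_criticalBeta {h θ b : ℝ} (hb : 0 < b) (hθ : 0 < θ)
    (hbθ : b * √θ = rho (Real.tanh (b * h))) : modify h θ = 1 / b ^ 2 := by
  rw [modify, tStar_of_criticalBeta hb hbθ, ← hbθ, mul_pow, Real.sq_sqrt hθ.le]
  field_simp

/-- The modified slope is 1/b² with b critical, and a steeper line b√θ meets the nonincreasing curve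
ρ(tanh(bh)) at a smaller b. Hence comparing modified slopes amounts to comparing slopes. -/
lemma modify_lt_modify {h θ θ' : ℝ} (hh : 0 ≤ h) (hθ : 0 < θ) (hlt : θ < θ') :
    modify h θ < modify h θ' := by
  obtain ⟨b, hb, hbθ⟩ := exists_criticalBeta hh hθ
  obtain ⟨b', hb', hbθ'⟩ := exists_criticalBeta hh (hθ.trans hlt)
  rw [modify_of_criticalBeta hb hθ hbθ, modify_of_criticalBeta hb' (hθ.trans hlt) hbθ']
  have hlt' : b' < b := by
    by_contra hle
    push Not at hle
    have h1 := rho_tanh_le (y := b * h) (z := b' * h) (by positivity) (by gcongr)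
    rw [← hbθ, ← hbθ'] at h1
    have h2 : √θ < √θ' := Real.sqrt_lt_sqrt hθ.le hlt
    have h3 : b * √θ < b' * √θ' := by
      calc b * √θ < b * √θ' := by gcongr
        _ ≤ b' * √θ' := by gcongr
    linarith
  gcongr

lemma modify_le_modify {h θ θ' : ℝ} (hh : 0 ≤ h) (hθ : 0 < θ) (hle : θ ≤ θ') :
    modify h θ ≤ modify h θ' := by
  rcases hle.eq_or_lt with rfl | hlt
  · rfl
  · exact (modify_lt_modify hh hθ hlt).le

end GREM

/-! ### Chord slopes and the coarse-graining indices. -/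

namespace GREM

namespace OrderParameter

variable {n : ℕ} (r : OrderParameter n)

lemma x_lt_x {i j : ℕ} (hij : i < j) (hj : j ≤ n) : r.x i < r.x j := by
  induction j, hij using Nat.le_induction with
  | base => exact r.x_lt i hj
  | succ j hij ih => exact (ih (by omega)).trans (r.x_lt j hj)

lemma q_lt_q {i j : ℕ} (hij : i < j) (hj : j ≤ n) : r.q i < r.q j := by
  induction j, hij using Nat.le_induction with
  | base => exact r.q_lt i hj
  | succ j hij ih => exact (ih (by omega)).trans (r.q_lt j hj)

lemma slope_succ (j k : ℕ) :
    r.slope (j + 1) k = (r.q k - r.q j) / (r.x k - r.x j) := rfl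

lemma slope_pos {j k : ℕ} (hjk : j < k) (hk : k ≤ n) : 0 < r.slope (j + 1) k := by
  rw [slope_succ]
  exact div_pos (sub_pos.2 (r.q_lt_q hjk hk)) (sub_pos.2 (r.x_lt_x hjk hk))

lemma modSlope_eq (h : ℝ) (j k : ℕ) : r.modSlope h j k = modify h (r.slope j k) := rfl

/-- Chord slopes after a point lying below a chord exceed the chord slopes before it. -/
lemma slope_le_slope_of_le {i j k : ℕ} (hij : i < j) (hjk : j < k) (hk : k ≤ n)
    (hle : r.slope (i + 1) j ≤ r.slope (i + 1) k) : r.slope (i + 1) j ≤ r.slope (j + 1) k := by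
  simp only [slope_succ] at *
  have h1 := sub_pos.2 (r.x_lt_x hij (hjk.le.trans hk))
  have h2 := sub_pos.2 (r.x_lt_x hjk hk)
  have h3 := sub_pos.2 (r.x_lt_x (hij.trans hjk) hk)
  rw [div_le_div_iff₀ h1 h3] at hle
  rw [div_le_div_iff₀ h1 h2]
  nlinarith

/-- The slope over [i, k] is a weighted mean of the slopes over [i, j] and [j, k]. -/
lemma slope_lt_slope_of_lt {i j k : ℕ} (hij : i < j) (hjk : j < k) (hk : k ≤ n)
    (hlt : r.slope (i + 1) k < r.slope (i + 1) j) : r.slope (j + 1) k < r.slope (i + 1) j := by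
  simp only [slope_succ] at *
  have h1 := sub_pos.2 (r.x_lt_x hij (hjk.le.trans hk))
  have h2 := sub_pos.2 (r.x_lt_x hjk hk)
  have h3 := sub_pos.2 (r.x_lt_x (hij.trans hjk) hk)
  rw [div_lt_div_iff₀ h3 h1] at hlt
  rw [div_lt_div_iff₀ h2 h1]
  nlinarith

variable {h : ℝ} (hh : 0 ≤ h)

lemma J_step (l : ℕ) (hl : r.J h l < n) :
    r.J h (l + 1) = sInf {j : ℕ | r.J h l < j ∧ j ≤ n ∧
        ∀ k, j < k → k ≤ n → r.modSlope h (j + 1) k < r.modSlope h (r.J h l + 1) j} := by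
  rw [J, if_pos hl]

lemma J_step_mem (l : ℕ) (hl : r.J h l < n) :
    r.J h l < r.J h (l + 1) ∧ r.J h (l + 1) ≤ n ∧ ∀ k, r.J h (l + 1) < k → k ≤ n →
      r.modSlope h (r.J h (l + 1) + 1) k < r.modSlope h (r.J h l + 1) (r.J h (l + 1)) := by
  have := Nat.sInf_mem (s := {j : ℕ | r.J h l < j ∧ j ≤ n ∧
        ∀ k, j < k → k ≤ n → r.modSlope h (j + 1) k < r.modSlope h (r.J h l + 1) j})
    ⟨n, hl, le_rfl, fun k h1 h2 => by omega⟩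
  rwa [← J_step r l hl] at this

include hh in
/-- The coarse-graining picks the (largest) point maximizing the chord slope. -/
lemma slope_le_slope_J (l : ℕ) (hl : r.J h l < n) {k : ℕ} (hk : r.J h l < k) (hkn : k ≤ n) :
    r.slope (r.J h l + 1) k ≤ r.slope (r.J h l + 1) (r.J h (l + 1)) := by
  set A := r.J h l
  obtain ⟨j₀, hj₀, hmax⟩ := (Finset.Ioc A n).exists_max_image (r.slope (A + 1)) ⟨n, by simp [hl]⟩
  -- the largest maximizer
  let S := (Finset.Ioc A n).filter fun j => r.slope (A + 1) j₀ ≤ r.slope (A + 1) j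
  have hS : S.Nonempty := ⟨j₀, by simp [S, Finset.mem_Ioc.1 hj₀]⟩
  set j := S.max' hS with hjdef
  have hjS : j ∈ S := S.max'_mem hS
  have hj : (A < j ∧ j ≤ n) ∧ r.slope (A + 1) j₀ ≤ r.slope (A + 1) j := by
    simpa [S] using hjS
  have hjmax : ∀ i, A < i → i ≤ n → r.slope (A + 1) i ≤ r.slope (A + 1) j := fun i h1 h2 =>
    (hmax i (by simp [h1, h2])).trans hj.2
  have hmem : j ∈ {j : ℕ | A < j ∧ j ≤ n ∧
        ∀ k, j < k → k ≤ n → r.modSlope h (j + 1) k < r.modSlope h (A + 1) j} := by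
    refine ⟨hj.1.1, hj.1.2, fun i hi hin => ?_⟩
    have hlt : r.slope (A + 1) i < r.slope (A + 1) j := by
      by_contra hc
      push Not at hc
      have : i ∈ S := by
        simp only [S, Finset.mem_filter, Finset.mem_Ioc]
        exact ⟨⟨hj.1.1.trans hi, hin⟩, hj.2.trans hc⟩
      have := S.le_max' i this
      omega
    rw [modSlope_eq, modSlope_eq]
    exact modify_lt_modify hh (r.slope_pos hi hin) (r.slope_lt_slope_of_lt hj.1.1 hi hin hlt)
  have hJle : r.J h (l + 1) ≤ j := by
    rw [J_step r l hl]; exact Nat.sInf_le hmem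
  obtain ⟨h1, h2, h3⟩ := r.J_step_mem l hl
  -- If J_{l+1} came strictly before the last maximizer j, the chord from J_{l+1} to j would be at
  -- least as steep as the one ending at J_{l+1}, against the defining property of J_{l+1}.
  rcases hJle.eq_or_lt with heq | hlt
  · rw [heq]; exact hjmax k hk hkn
  · exfalso
    have h4 := h3 j hlt hj.1.2
    rw [modSlope_eq, modSlope_eq] at h4
    have h5 := r.slope_le_slope_of_le h1 hlt hj.1.2 (hjmax _ h1 h2)
    exact absurd (modify_le_modify hh (r.slope_pos h1 h2) h5) (not_le.2 h4)

lemma J_le (l : ℕ) : r.J h l ≤ n := by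
  cases l with
  | zero => simp [J]
  | succ l =>
    by_cases hl : r.J h l < n
    · exact (r.J_step_mem l hl).2.1
    · rw [J, if_neg hl]

lemma J_lt_or_eq (l : ℕ) : l ≤ r.J h l ∨ r.J h l = n := by
  induction l with
  | zero => simp
  | succ l ih =>
    by_cases hl : r.J h l < n
    · have := (r.J_step_mem l hl).1
      left; omega
    · right; rw [J, if_neg hl]

lemma J_m : r.J h (r.m h) = n := by
  -- Below n the sequence grows by at least one at each step, so it has reached n by index n.
  refine Nat.sInf_mem (s := {l : ℕ | r.J h l = n}) ⟨n, ?_⟩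
  rcases r.J_lt_or_eq (h := h) n with h1 | h1
  · exact le_antisymm (r.J_le n) h1
  · exact h1

lemma J_lt_of_lt_m {l : ℕ} (hl : l < r.m h) : r.J h l < n :=
  lt_of_le_of_ne (r.J_le l) fun he => Nat.notMem_of_lt_sInf hl he

lemma J_mono : Monotone (r.J h) := by
  refine monotone_nat_of_le_succ fun l => ?_
  by_cases hl : r.J h l < n
  · exact (r.J_step_mem l hl).1.le
  · rw [J, if_neg hl]; exact r.J_le l

/-- The index `l` of the block `[J_l, J_{l+1})` containing `k`. -/
def blockIndex (h : ℝ) (k : ℕ) : ℕ := sInf {l | k < r.J h (l + 1)}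

lemma blockIndex_eq {k l : ℕ} (h1 : r.J h l ≤ k) (h2 : k < r.J h (l + 1)) :
    r.blockIndex h k = l := by
  refine le_antisymm (Nat.sInf_le h2) ?_
  by_contra hc
  push Not at hc
  have hm : k < r.J h (r.blockIndex h k + 1) :=
    Nat.sInf_mem (s := {l | k < r.J h (l + 1)}) ⟨l, h2⟩
  have := r.J_mono (h := h) hc
  exact absurd (hm.trans_le this) (not_lt.2 h1)

lemma blockIndex_spec {k : ℕ} (hk : k < n) :
    r.blockIndex h k < r.m h ∧ r.J h (r.blockIndex h k) ≤ k ∧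
      k < r.J h (r.blockIndex h k + 1) := by
  have hm0 : r.m h ≠ 0 := by
    intro h0
    have := r.J_m (h := h)
    rw [h0] at this
    simp only [J] at this
    omega
  have hne : (r.m h - 1) ∈ {l | k < r.J h (l + 1)} := by
    change k < r.J h (r.m h - 1 + 1)
    rw [Nat.sub_add_cancel (Nat.pos_of_ne_zero hm0), r.J_m]
    exact hk
  have hle : r.blockIndex h k ≤ r.m h - 1 := Nat.sInf_le hne
  have hmem : k < r.J h (r.blockIndex h k + 1) := Nat.sInf_mem ⟨_, hne⟩
  refine ⟨by omega, ?_, hmem⟩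
  rcases Nat.eq_zero_or_pos (r.blockIndex h k) with h0 | h0
  · rw [h0]; simp [J]
  · by_contra hc
    push Not at hc
    have : r.blockIndex h k ≤ r.blockIndex h k - 1 := Nat.sInf_le (by
      change k < r.J h (r.blockIndex h k - 1 + 1)
      rwa [Nat.sub_add_cancel h0])
    omega

lemma sum_range_J (f : ℕ → ℝ) (l : ℕ) :
    ∑ k ∈ Finset.range (r.J h l), f k
      = ∑ i ∈ Finset.range l, ∑ k ∈ Finset.Ico (r.J h i) (r.J h (i + 1)), f k := by
  induction l with
  | zero => simp [J]
  | succ l ih =>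
    rw [Finset.sum_range_succ, ← ih, Finset.range_eq_Ico, Finset.range_eq_Ico,
      Finset.sum_Ico_consecutive _ (Nat.zero_le _) (r.J_mono (Nat.le_succ l))]

lemma sum_range_eq_sum_blocks (f : ℕ → ℝ) :
    ∑ k ∈ Finset.range n, f k
      = ∑ i ∈ Finset.range (r.m h), ∑ k ∈ Finset.Ico (r.J h i) (r.J h (i + 1)), f k := by
  rw [← sum_range_J, J_m]

lemma sum_Ico_affine {g g' : ℕ → ℝ} {a b : ℕ} (hab : a ≤ b) (c c' : ℝ) :
    ∑ k ∈ Finset.Ico a b, ((g (k + 1) - g k) * c + (g' (k + 1) - g' k) * c')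
      = (g b - g a) * c + (g' b - g' a) * c' := by
  rw [Finset.sum_add_distrib, ← Finset.sum_mul, ← Finset.sum_mul, Finset.sum_Ico_sub g hab,
    Finset.sum_Ico_sub g' hab]

/-! ### The level-dependent inverse temperatures. -/

variable {β : ℝ} (hβ : 0 < β)

include hh hβ in
/-- Level-dependent inverse temperatures which certify the limiting free energy from both sides. -/
theorem exists_levelBeta : ∃ b : ℕ → ℝ,
    (∀ k < n, 0 < b k ∧ b k ≤ β) ∧ (∀ k, k + 1 < n → b k ≤ b (k + 1)) ∧
    (∀ K ≤ n, 0 ≤ ∑ k ∈ Finset.range K, ((r.x (k + 1) - r.x k) * entropy (Real.tanh (b k * h))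
      - (b k) ^ 2 * (r.q (k + 1) - r.q k) / 2)) ∧
    ∑ k ∈ Finset.range n, (β / b k * ((r.x (k + 1) - r.x k) * Real.log (2 * Real.cosh (b k * h)))
      + β * b k * (r.q (k + 1) - r.q k) / 2) = r.limitFreeEnergy β h ∧
    ∑ k ∈ Finset.range n, ((r.x (k + 1) - r.x k) * entropy (Real.tanh (b k * h))
      - (b k) ^ 2 * (r.q (k + 1) - r.q k) / 2 + β * b k * (r.q (k + 1) - r.q k)
      + β * h * ((r.x (k + 1) - r.x k) * Real.tanh (b k * h))) = r.limitFreeEnergy β h := by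
  have hc : ∀ l, ∃ c, l < r.m h → 0 < c ∧
      c * √(r.slope (r.J h l + 1) (r.J h (l + 1))) = rho (Real.tanh (c * h)) := by
    intro l
    by_cases hl : l < r.m h
    · obtain ⟨h1, h2, -⟩ := r.J_step_mem l (r.J_lt_of_lt_m hl)
      obtain ⟨c, hc⟩ := exists_criticalBeta hh (r.slope_pos h1 h2)
      exact ⟨c, fun _ => hc⟩
    · exact ⟨0, fun hl' => absurd hl' hl⟩
  choose c hc using hc
  have hJ := fun l (hl : l < r.m h) => r.J_step_mem l (r.J_lt_of_lt_m hl)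
  have hgamma : ∀ l < r.m h, r.gammaBar h (l + 1) = 1 / c l := by
    intro l hl
    obtain ⟨h1, h2, -⟩ := hJ l hl
    rw [gammaBar, Nat.add_sub_cancel, modSlope_eq,
      modify_of_criticalBeta (hc l hl).1 (r.slope_pos h1 h2) (hc l hl).2,
      Real.sqrt_div zero_le_one, Real.sqrt_one, Real.sqrt_sq (hc l hl).1.le]
  -- The definition of J makes the modified slopes 1/c² of successive blocks strictly decrease.
  have hcmono : ∀ l, l + 1 < r.m h → c l < c (l + 1) := by
    intro l hl
    obtain ⟨h1, h2, h3⟩ := hJ l (by omega)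
    obtain ⟨h1', h2', -⟩ := hJ (l + 1) hl
    have h4 := h3 _ h1' h2'
    have p1 := hc l (by omega)
    have p2 := hc (l + 1) hl
    rw [modSlope_eq, modSlope_eq, modify_of_criticalBeta p2.1 (r.slope_pos h1' h2') p2.2,
      modify_of_criticalBeta p1.1 (r.slope_pos h1 h2) p1.2,
      one_div_lt_one_div (pow_pos p2.1 2) (pow_pos p1.1 2)] at h4
    exact lt_of_pow_lt_pow_left₀ 2 p2.1.le h4
  have hcmono' : ∀ i j, i ≤ j → j < r.m h → c i ≤ c j := by
    intro i j hij hj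
    induction j, hij using Nat.le_induction with
    | base => rfl
    | succ j hij ih => exact (ih (by omega)).trans (hcmono j hj).le
  have hFm : r.frozenLevel β h ≤ r.m h := by
    refine Finset.sup_le fun l hl => ?_
    simp only [Finset.mem_filter, Finset.mem_Icc] at hl
    exact hl.1.2
  -- The block [J_l, J_{l+1}) has index l here but l + 1 in `gammaBar` and `frozenLevel`, hence the
  -- strict inequality. As c increases, the frozen blocks form an initial segment.
  have hF : ∀ l < r.m h, l < r.frozenLevel β h ↔ c l < β := by
    intro l hl
    have hiff : ∀ l < r.m h, 1 < β * r.gammaBar h (l + 1) ↔ c l < β := by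
      intro l hl
      rw [hgamma l hl, mul_one_div, lt_div_iff₀ (hc l hl).1, one_mul]
    constructor
    · intro hlt
      rw [frozenLevel, Finset.lt_sup_iff] at hlt
      obtain ⟨j, hj, hlj⟩ := hlt
      simp only [Finset.mem_filter, Finset.mem_Icc, id] at hj hlj
      obtain ⟨j, rfl⟩ := Nat.exists_eq_add_of_le' hj.1.1
      have := (hiff j (by omega)).1 hj.2
      exact (hcmono' l j (by omega) (by omega)).trans_lt this
    · intro hlt
      have : l + 1 ≤ r.frozenLevel β h := by
        refine Finset.le_sup (f := id) (b := l + 1) ?_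
        simp only [Finset.mem_filter, Finset.mem_Icc]
        exact ⟨⟨by omega, hl⟩, (hiff l hl).2 hlt⟩
      omega
  -- A frozen block stays at its critical inverse temperature; the others use β itself.
  set b : ℕ → ℝ := fun k => min β (c (r.blockIndex h k)) with hb
  have hbk : ∀ l k, r.J h l ≤ k → k < r.J h (l + 1) → b k = min β (c l) := by
    intro l k h1 h2
    rw [hb]; simp only [r.blockIndex_eq h1 h2]
  have hpos : ∀ k < n, 0 < b k ∧ b k ≤ β := by
    intro k hk
    obtain ⟨h1, -, -⟩ := r.blockIndex_spec (h := h) hk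
    exact ⟨lt_min hβ (hc _ h1).1, min_le_left _ _⟩
  -- sums over (partial) blocks
  have hblock : ∀ l < r.m h, ∀ K, r.J h l ≤ K → K ≤ r.J h (l + 1) →
      0 ≤ ∑ k ∈ Finset.Ico (r.J h l) K,
        ((r.x (k + 1) - r.x k) * entropy (Real.tanh (b k * h))
          - (b k) ^ 2 * (r.q (k + 1) - r.q k) / 2) := by
    intro l hl K h1 h2
    set B := min β (c l) with hB
    have hBpos : 0 < B := lt_min hβ (hc _ hl).1
    have e : ∑ k ∈ Finset.Ico (r.J h l) K,
        ((r.x (k + 1) - r.x k) * entropy (Real.tanh (b k * h))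
          - (b k) ^ 2 * (r.q (k + 1) - r.q k) / 2)
        = ∑ k ∈ Finset.Ico (r.J h l) K, ((r.x (k + 1) - r.x k) * entropy (Real.tanh (B * h))
          + (r.q (k + 1) - r.q k) * (- B ^ 2 / 2)) := by
      refine Finset.sum_congr rfl fun k hk => ?_
      rw [Finset.mem_Ico] at hk
      rw [hbk l k hk.1 (hk.2.trans_le h2)]; ring
    rw [e, sum_Ico_affine h1]
    rcases h1.eq_or_lt with rfl | h1
    · simp
    obtain ⟨g1, g2, -⟩ := hJ l hl
    have hsl := r.slope_le_slope_J hh l (r.J_lt_of_lt_m hl) h1 (h2.trans g2)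
    set θ := r.slope (r.J h l + 1) (r.J h (l + 1)) with hθ
    have hθpos : 0 < θ := r.slope_pos g1 g2
    have hx := sub_pos.2 (r.x_lt_x h1 (h2.trans g2))
    rw [slope_succ, div_le_iff₀ hx] at hsl
    -- Equality holds at B = c_l by criticality; lowering B decreases the left side and does not
    -- decrease the right. Since θ is the largest chord slope from J_l, this pays for every partial
    -- block.
    have hent : B ^ 2 * θ ≤ 2 * entropy (Real.tanh (B * h)) := by
      have k1 : B ^ 2 * θ ≤ (c l) ^ 2 * θ := by gcongr; exact min_le_right _ _
      have k2 : (c l) ^ 2 * θ = rho (Real.tanh (c l * h)) ^ 2 := by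
        rw [← (hc l hl).2, mul_pow, Real.sq_sqrt hθpos.le]
      have k3 := entropy_tanh_le (y := B * h) (z := c l * h) (by positivity)
        (by gcongr; exact min_le_right _ _)
      rw [rho_tanh_sq] at k2
      linarith
    have m1 := mul_le_mul_of_nonneg_left hsl (sq_nonneg B)
    have m2 := mul_le_mul_of_nonneg_left hent hx.le
    nlinarith
  have hval : ∀ l < r.m h,
      (β / min β (c l) * ((r.x (r.J h (l + 1)) - r.x (r.J h l)) *
          Real.log (2 * Real.cosh (min β (c l) * h)))
        + β * min β (c l) * (r.q (r.J h (l + 1)) - r.q (r.J h l)) / 2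
        = if l < r.frozenLevel β h then
            β * (√(r.xBar h (l + 1) * r.qBar h (l + 1)) * rho (tStar (h / √(r.thetaBar h (l + 1))))
              + h * r.xBar h (l + 1) * tStar (h / √(r.thetaBar h (l + 1))))
          else (r.x (r.J h (l + 1)) - r.x (r.J h l)) * (Real.log 2 + Real.log (Real.cosh (β * h)))
            + (r.q (r.J h (l + 1)) - r.q (r.J h l)) * (1 / 2 * β ^ 2)) ∧
      ((r.x (r.J h (l + 1)) - r.x (r.J h l)) * entropy (Real.tanh (min β (c l) * h))
        - (min β (c l)) ^ 2 * (r.q (r.J h (l + 1)) - r.q (r.J h l)) / 2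
        + β * min β (c l) * (r.q (r.J h (l + 1)) - r.q (r.J h l))
        + β * h * ((r.x (r.J h (l + 1)) - r.x (r.J h l)) * Real.tanh (min β (c l) * h))
        = if l < r.frozenLevel β h then
            β * (√(r.xBar h (l + 1) * r.qBar h (l + 1)) * rho (tStar (h / √(r.thetaBar h (l + 1))))
              + h * r.xBar h (l + 1) * tStar (h / √(r.thetaBar h (l + 1))))
          else (r.x (r.J h (l + 1)) - r.x (r.J h l)) * (Real.log 2 + Real.log (Real.cosh (β * h)))
            + (r.q (r.J h (l + 1)) - r.q (r.J h l)) * (1 / 2 * β ^ 2)) := by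
    intro l hl
    obtain ⟨g1, g2, -⟩ := hJ l hl
    have hx := sub_pos.2 (r.x_lt_x g1 g2)
    have hq := sub_pos.2 (r.q_lt_q g1 g2)
    obtain ⟨hc0, hcθ⟩ := hc l hl
    split_ifs with hlF
    · have hlt := (hF l hl).1 hlF
      rw [min_eq_right hlt.le]
      have htheta : r.thetaBar h (l + 1) = r.slope (r.J h l + 1) (r.J h (l + 1)) := rfl
      -- In a frozen block the entropy constraint is an equality over the whole block; this is what
      -- makes the upper and lower values agree.
      have hent : (r.x (r.J h (l + 1)) - r.x (r.J h l)) * (2 * entropy (Real.tanh (c l * h)))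
          = (c l) ^ 2 * (r.q (r.J h (l + 1)) - r.q (r.J h l)) := by
        rw [← rho_tanh_sq, ← hcθ, mul_pow, Real.sq_sqrt (r.slope_pos g1 g2).le, slope_succ]
        field_simp
      have hsq : √(r.xBar h (l + 1) * r.qBar h (l + 1)) * rho (Real.tanh (c l * h))
          = c l * (r.q (r.J h (l + 1)) - r.q (r.J h l)) := by
        change √((r.x (r.J h (l + 1)) - r.x (r.J h l)) * (r.q (r.J h (l + 1)) - r.q (r.J h l)))
          * _ = _
        rw [← hcθ, mul_left_comm, ← Real.sqrt_mul (by positivity), slope_succ]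
        congr 1
        rw [Real.sqrt_eq_iff_mul_self_eq (by positivity) hq.le]
        field_simp
      have hxb : r.xBar h (l + 1) = r.x (r.J h (l + 1)) - r.x (r.J h l) := rfl
      rw [htheta, tStar_of_criticalBeta hc0 hcθ, hsq, hxb, ← entropy_tanh]
      constructor
      · field_simp
        linear_combination hent
      · linear_combination (1 / 2) * hent
    · have hle : β ≤ c l := not_lt.1 fun hlt => hlF ((hF l hl).2 hlt)
      rw [min_eq_left hle, ← log_two_mul_cosh]
      constructor
      · rw [div_self hβ.ne']; ring
      · rw [← entropy_tanh]; ring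
  have htotal : ∑ l ∈ Finset.range (r.m h), (if l < r.frozenLevel β h then
            β * (√(r.xBar h (l + 1) * r.qBar h (l + 1)) * rho (tStar (h / √(r.thetaBar h (l + 1))))
              + h * r.xBar h (l + 1) * tStar (h / √(r.thetaBar h (l + 1))))
          else (r.x (r.J h (l + 1)) - r.x (r.J h l)) * (Real.log 2 + Real.log (Real.cosh (β * h)))
            + (r.q (r.J h (l + 1)) - r.q (r.J h l)) * (1 / 2 * β ^ 2)) = r.limitFreeEnergy β h := by
    -- Split at the frozen level; the increments over the remaining blocks telescope to 1 - x and 1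
    -- - q.
    rw [Finset.range_eq_Ico, ← Finset.sum_Ico_consecutive _ (Nat.zero_le _) hFm,
      Finset.sum_congr rfl (fun l hl => if_pos (Finset.mem_Ico.1 hl).2),
      Finset.sum_congr (s₁ := Finset.Ico (r.frozenLevel β h) (r.m h)) rfl
        (fun l hl => if_neg (not_lt.2 (Finset.mem_Ico.1 hl).1)),
      sum_Ico_affine (g := fun l => r.x (r.J h l)) (g' := fun l => r.q (r.J h l)) hFm,
      r.J_m, r.x_last, r.q_last, limitFreeEnergy, ← Finset.mul_sum, ← Finset.range_eq_Ico,
      Finset.range_eq_Ico, Finset.sum_Ico_add' (fun l =>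
        √(r.xBar h l * r.qBar h l) * rho (tStar (h / √(r.thetaBar h l)))
              + h * r.xBar h l * tStar (h / √(r.thetaBar h l))) 0 _ 1]
    have : Finset.Ico (0 + 1) (r.frozenLevel β h + 1) = Finset.Icc 1 (r.frozenLevel β h) := by
      ext; simp only [Finset.mem_Ico, Finset.mem_Icc]; omega
    rw [this]; ring
  refine ⟨b, hpos, ?_, ?_, ?_, ?_⟩
  · intro k hk
    obtain ⟨h1, h2, h3⟩ := r.blockIndex_spec (h := h) (show k < n by omega)
    obtain ⟨h1', h2', h3'⟩ := r.blockIndex_spec (h := h) hk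
    refine min_le_min_left _ (hcmono' _ _ ?_ h1')
    by_contra hc
    push Not at hc
    have := r.J_mono (h := h) hc
    have h4 : r.J h (r.blockIndex h (k + 1) + 1) ≤ r.J h (r.blockIndex h k) := this
    omega
  · intro K hK
    have hfull : ∀ l ≤ r.m h, 0 ≤ ∑ k ∈ Finset.range (r.J h l),
        ((r.x (k + 1) - r.x k) * entropy (Real.tanh (b k * h))
          - (b k) ^ 2 * (r.q (k + 1) - r.q k) / 2) := by
      intro l hl
      rw [sum_range_J]
      refine Finset.sum_nonneg fun i hi => hblock i ?_ _ (r.J_mono (Nat.le_succ i)) le_rfl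
      have := Finset.mem_range.1 hi
      omega
    rcases hK.eq_or_lt with rfl | hK
    · have := hfull _ le_rfl
      rwa [r.J_m] at this
    · obtain ⟨h1, h2, h3⟩ := r.blockIndex_spec (h := h) hK
      -- A prefix of levels consists of complete blocks and one initial piece of a block.
      rw [← Finset.sum_range_add_sum_Ico _ h2]
      exact add_nonneg (hfull _ h1.le) (hblock _ h1 K h2 h3.le)
  · rw [← htotal]
    rw [r.sum_range_eq_sum_blocks (h := h)]
    refine Finset.sum_congr rfl fun l hl => ?_
    rw [← (hval l (Finset.mem_range.1 hl)).1]
    trans ∑ k ∈ Finset.Ico (r.J h l) (r.J h (l + 1)), ((r.x (k + 1) - r.x k) *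
      (β / min β (c l) * Real.log (2 * Real.cosh (min β (c l) * h)))
      + (r.q (k + 1) - r.q k) * (β * min β (c l) / 2))
    · refine Finset.sum_congr rfl fun k hk => ?_
      rw [Finset.mem_Ico] at hk
      rw [hbk l k hk.1 hk.2]; ring
    · rw [sum_Ico_affine (r.J_mono (Nat.le_succ l))]; ring
  · rw [← htotal]
    rw [r.sum_range_eq_sum_blocks (h := h)]
    refine Finset.sum_congr rfl fun l hl => ?_
    rw [← (hval l (Finset.mem_range.1 hl)).2]
    trans ∑ k ∈ Finset.Ico (r.J h l) (r.J h (l + 1)), ((r.x (k + 1) - r.x k) *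
      (entropy (Real.tanh (min β (c l) * h)) + β * h * Real.tanh (min β (c l) * h))
      + (r.q (k + 1) - r.q k) * (- (min β (c l)) ^ 2 / 2 + β * min β (c l)))
    · refine Finset.sum_congr rfl fun k hk => ?_
      rw [Finset.mem_Ico] at hk
      rw [hbk l k hk.1 hk.2]; ring
    · rw [sum_Ico_affine (r.J_mono (Nat.le_succ l))]; ring

end OrderParameter
end GREM

namespace GREM

/-! ### The tree representation of the process -/

variable {N : ℕ}

/-- The configuration which agrees with `σ` on the first `ℓ` coordinates and is `1` elsewhere.
It encodes the initial segment of `σ` of length `ℓ`. -/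
def trunc (ℓ : ℕ) (σ : Config N) : Config N := fun i => if i.val < ℓ then σ i else 1

lemma trunc_trunc (a b : ℕ) (σ : Config N) : trunc a (trunc b σ) = trunc (min a b) σ := by
  ext i
  simp only [trunc, lt_min_iff]
  split_ifs with h1 h2 h3 <;> simp_all

lemma trunc_of_le {ℓ : ℕ} (h : N ≤ ℓ) (σ : Config N) : trunc ℓ σ = σ := by
  ext i
  simp [trunc, i.isLt.trans_le h]

lemma trunc_zero (σ : Config N) : trunc 0 σ = 1 := by
  ext i; simp [trunc]

lemma trunc_eq_trunc_iff {ℓ : ℕ} {σ τ : Config N} :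
    trunc ℓ σ = trunc ℓ τ ↔ ∀ i : Fin N, i.val < ℓ → σ i = τ i := by
  constructor
  · intro h i hi
    have := congrFun h i
    simpa [trunc, hi] using this
  · intro h
    funext i
    simp only [trunc]
    split_ifs with hi
    · exact h i hi
    · rfl

lemma trunc_eq_trunc_of_le {a b : ℕ} (hab : a ≤ b) {σ τ : Config N}
    (h : trunc b σ = trunc b τ) : trunc a σ = trunc a τ := by
  rw [trunc_eq_trunc_iff] at *
  exact fun i hi => h i (hi.trans_le hab)

lemma trunc_eq_trunc_iff_le_commonPrefix {ℓ : ℕ} (hℓ : ℓ ≤ N) {σ τ : Config N} :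
    trunc ℓ σ = trunc ℓ τ ↔ ℓ ≤ commonPrefix σ τ := by
  rw [trunc_eq_trunc_iff]
  constructor
  · exact fun h => Nat.le_findGreatest hℓ h
  · intro h i hi
    have := Nat.findGreatest_spec (P := fun k => ∀ i : Fin N, i.val < k → σ i = τ i)
      (Nat.zero_le N) (fun i hi => absurd hi (Nat.not_lt_zero _))
    exact this i (hi.trans_le h)

lemma OrderParameter.x_le_x {n : ℕ} (r : OrderParameter n) {i j : ℕ} (hij : i ≤ j) (hj : j ≤ n) :
    r.x i ≤ r.x j := by
  rcases hij.eq_or_lt with rfl | hij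
  · rfl
  · exact (r.x_lt_x hij hj).le

/-- The step function as a sum of its jumps. -/
lemma OrderParameter.toFun_eq_sum {n : ℕ} (r : OrderParameter n) {y : ℝ} (hy : 0 ≤ y) :
    r.toFun y = ∑ k ∈ Finset.range n, (r.q (k + 1) - r.q k) * if r.x (k + 1) ≤ y then 1 else 0 := by
  classical
  set K := Nat.findGreatest (fun k => r.x k ≤ y) n with hK
  have hKn : K ≤ n := Nat.findGreatest_le n
  have hKy : r.x K ≤ y :=
    Nat.findGreatest_spec (P := fun k => r.x k ≤ y) (Nat.zero_le n) (by rwa [r.x_zero])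
  have hlt : ∀ k, K < k → k ≤ n → y < r.x k := fun k h1 h2 =>
    not_le.1 (Nat.findGreatest_is_greatest h1 h2)
  have hset : ∀ k ≤ n, y ∈ r.stepSet k ↔ k = K := by
    intro k hk
    rw [stepSet]
    constructor
    · intro h
      by_contra hne
      rcases Nat.lt_or_gt_of_ne hne with h1 | h1
      · rw [if_pos (by omega)] at h
        have := r.x_le_x (show k + 1 ≤ K by omega) hKn
        exact absurd h.2 (not_lt.2 (this.trans hKy))
      · have := hlt k h1 hk
        split_ifs at h with h2
        · exact absurd h.1 (not_le.2 this)
        · exact absurd h (not_le.2 this)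
    · rintro rfl
      split_ifs with h
      · exact ⟨hKy, hlt _ (Nat.lt_succ_self _) h⟩
      · exact hKy
  have h1 : r.toFun y = r.q K := by
    rw [toFun]
    rcases Nat.eq_zero_or_pos K with h0 | h0
    · rw [h0, r.q_zero]
      refine Finset.sum_eq_zero fun k hk => ?_
      rw [Finset.mem_Icc] at hk
      exact Set.indicator_of_notMem (fun h => by have := (hset k hk.2).1 h; omega) _
    · rw [Finset.sum_eq_single_of_mem K (Finset.mem_Icc.2 ⟨h0, hKn⟩)]
      · exact Set.indicator_of_mem ((hset K hKn).2 rfl) _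
      · intro k hk hne
        rw [Finset.mem_Icc] at hk
        exact Set.indicator_of_notMem (fun h => hne ((hset k hk.2).1 h)) _
  rw [h1, Finset.range_eq_Ico, ← Finset.sum_Ico_consecutive _ (Nat.zero_le K) hKn]
  rw [Finset.sum_congr rfl (g := fun k => r.q (k + 1) - r.q k),
    Finset.sum_congr (s₁ := Finset.Ico K n) rfl (g := fun k => 0)]
  · rw [Finset.sum_Ico_sub r.q (Nat.zero_le K), r.q_zero]; simp
  · intro k hk
    rw [Finset.mem_Ico] at hk
    rw [if_neg (not_le.2 (hlt _ (by omega) (by omega))), mul_zero]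
  · intro k hk
    rw [Finset.mem_Ico] at hk
    rw [if_pos ((r.x_le_x (show k + 1 ≤ K by omega) hKn).trans hKy), mul_one]

/-! ### Independent Gaussians on the vertices and identification of the law. -/

variable {n : ℕ}

/-- The index set of the independent Gaussian variables attached to the vertices of the tree. -/
abbrev Vertex (n N : ℕ) : Type := Fin n × Config N

/-- The law of independent standard Gaussian variables attached to the vertices of the tree. -/
def vertexMeasure (n N : ℕ) : Measure (Vertex n N → ℝ) :=
  Measure.pi fun _ => gaussianReal 0 1

instance : IsProbabilityMeasure (vertexMeasure n N) := by
  unfold vertexMeasure; infer_instance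

/-- The Gaussian field obtained by summing weighted vertex variables along a branch. -/
def treeField (r : OrderParameter n) (L : ℕ → ℕ) (g : Vertex n N → ℝ) (σ : Config N) : ℝ :=
  ∑ k : Fin n, √(r.q (k + 1) - r.q k) * g (k, trunc (L (k + 1)) σ)

lemma measurePreserving_vertex (v : Vertex n N) :
    MeasurePreserving (fun g : Vertex n N → ℝ => g v) (vertexMeasure n N) (gaussianReal 0 1) :=
  measurePreserving_eval _ v

lemma iIndepFun_vertex :
    iIndepFun (fun (v : Vertex n N) (g : Vertex n N → ℝ) => g v) (vertexMeasure n N) :=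
  iIndepFun_pi (X := fun _ x => x) fun _ => measurable_id.aemeasurable

lemma hasGaussianLaw_vertex (v : Vertex n N) :
    HasGaussianLaw (fun g : Vertex n N → ℝ => g v) (vertexMeasure n N) where
  isGaussian_map := by
    rw [(measurePreserving_vertex v).map_eq]; infer_instance

lemma integral_vertex (v : Vertex n N) : ∫ g, g v ∂(vertexMeasure n N) = 0 := by
  rw [← integral_id_gaussianReal (μ := 0) (v := 1), ← (measurePreserving_vertex (n := n) v).map_eq,
    integral_map (measurable_pi_apply v).aemeasurable (by fun_prop)]

lemma integral_vertex_mul (v w : Vertex n N) :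
    ∫ g, g v * g w ∂(vertexMeasure n N) = if v = w then 1 else 0 := by
  split_ifs with h
  · subst h
    have hv : Var[fun x : ℝ => x; gaussianReal 0 1] = 1 := by
      simp
    rw [variance_of_integral_eq_zero (by fun_prop) (by simp)] at hv
    rw [← hv, ← (measurePreserving_vertex (n := n) v).map_eq,
      integral_map (measurable_pi_apply v).aemeasurable (by fun_prop)]
    simp [pow_two]
  · have := (iIndepFun_vertex (n := n) (N := N)).indepFun h
    rw [this.integral_fun_mul_eq_mul_integral (measurable_pi_apply v).aestronglyMeasurable
      (measurable_pi_apply w).aestronglyMeasurable, integral_vertex]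
    simp

/-- The characteristic function of a centered Gaussian vector involves only second moments, so these
determine its law. -/
lemma charFunDual_map_of_centered {ι Ω : Type*} [Fintype ι] [DecidableEq ι] [MeasurableSpace Ω]
    {P : Measure Ω} {X : Ω → ι → ℝ} (hX : HasGaussianLaw X P) (h0 : ∀ i, ∫ ω, X ω i ∂P = 0)
    (L : StrongDual ℝ (ι → ℝ)) :
    charFunDual (P.map X) L = Complex.exp (-(((∑ i, ∑ j, L (Pi.single i 1) * L (Pi.single j 1) *
      ∫ ω, X ω i * X ω j ∂P : ℝ)) : ℂ) / 2) := by
  have hLX : ∀ ω, L (X ω) = ∑ i, L (Pi.single i 1) * X ω i := by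
    intro ω
    conv_lhs => rw [pi_eq_sum_univ' (X ω)]
    rw [map_sum]
    refine Finset.sum_congr rfl fun i _ => ?_
    rw [map_smul, smul_eq_mul, mul_comm]
  have hmem : ∀ i, MemLp (fun ω => X ω i) 2 P := fun i => (hX.eval i).memLp_two
  have hint : ∀ i, Integrable (fun ω => X ω i) P := fun i => (hX.eval i).integrable
  have hmean : ∫ ω, L (X ω) ∂P = 0 := by
    simp_rw [hLX]
    rw [integral_finsetSum _ fun i _ => (hint i).const_mul _]
    simp [integral_const_mul, h0]
  rw [hX.charFunDual_map_eq_fun, hmean,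
    variance_of_integral_eq_zero (hX.map_fun L).aemeasurable hmean]
  have : ∫ ω, L (X ω) ^ 2 ∂P = ∑ i, ∑ j, L (Pi.single i 1) * L (Pi.single j 1) *
      ∫ ω, X ω i * X ω j ∂P := by
    simp_rw [hLX, pow_two, Finset.sum_mul_sum]
    have hij : ∀ i j, Integrable (fun ω => L (Pi.single i 1) * X ω i *
        (L (Pi.single j 1) * X ω j)) P := fun i j => by
      have := ((hmem i).integrable_mul (hmem j)).const_mul
        (L (Pi.single i 1) * L (Pi.single j 1))
      refine this.congr (Eventually.of_forall fun ω => ?_)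
      simp only [Pi.mul_apply]; ring
    rw [integral_finsetSum _ fun i _ => integrable_finsetSum _ fun j _ => hij i j]
    refine Finset.sum_congr rfl fun i _ => ?_
    rw [integral_finsetSum _ fun j _ => hij i j]
    refine Finset.sum_congr rfl fun j _ => ?_
    rw [← integral_const_mul]
    congr 1; ext ω; ring
  rw [this]
  congr 1
  push_cast; ring

/-- Two centered Gaussian vectors with the same covariance have the same law. -/
lemma map_eq_map_of_covariance {ι Ω Ω' : Type*} [Fintype ι] [MeasurableSpace Ω]
    [MeasurableSpace Ω'] {P : Measure Ω} {P' : Measure Ω'} {X : Ω → ι → ℝ} {X' : Ω' → ι → ℝ}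
    (hX : HasGaussianLaw X P) (hX' : HasGaussianLaw X' P')
    (h0 : ∀ i, ∫ ω, X ω i ∂P = 0) (h0' : ∀ i, ∫ ω, X' ω i ∂P' = 0)
    (hc : ∀ i j, ∫ ω, X ω i * X ω j ∂P = ∫ ω, X' ω i * X' ω j ∂P') : P.map X = P'.map X' := by
  classical
  have := hX.isProbabilityMeasure
  have := hX'.isProbabilityMeasure
  have := hX.isGaussian_map
  have := hX'.isGaussian_map
  apply Measure.ext_of_charFunDual
  ext L
  rw [charFunDual_map_of_centered hX h0, charFunDual_map_of_centered hX' h0']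
  simp_rw [hc]

lemma measurable_treeField (r : OrderParameter n) (L : ℕ → ℕ) :
    Measurable (treeField r L : (Vertex n N → ℝ) → Config N → ℝ) := by
  unfold treeField; fun_prop

lemma hasGaussianLaw_treeField (r : OrderParameter n) (L : ℕ → ℕ) :
    HasGaussianLaw (fun g : Vertex n N → ℝ => treeField r L g) (vertexMeasure n N) := by
  have h1 : HasGaussianLaw (fun (g : Vertex n N → ℝ) v => g v) (vertexMeasure n N) :=
    iIndepFun_vertex.hasGaussianLaw hasGaussianLaw_vertex
  let T : (Vertex n N → ℝ) →L[ℝ] (Config N → ℝ) :=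
    ContinuousLinearMap.pi fun σ => ∑ k : Fin n, √(r.q (k + 1) - r.q k) •
      ContinuousLinearMap.proj (R := ℝ) (φ := fun _ : Vertex n N => ℝ) (k, trunc (L (k + 1)) σ)
  have h2 : (fun g : Vertex n N → ℝ => treeField r L g) = fun g => T g := by
    ext g σ
    simp [T, treeField]
  rw [h2]
  exact h1.map_fun T

lemma integral_treeField (r : OrderParameter n) (L : ℕ → ℕ) (σ : Config N) :
    ∫ g, treeField r L g σ ∂(vertexMeasure n N) = 0 := by
  unfold treeField
  rw [integral_finsetSum _ fun k _ => ((hasGaussianLaw_vertex _).integrable).const_mul _]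
  simp [integral_const_mul, integral_vertex]

/-- Different levels use different vertices, so only equal levels contribute, and at a given level
two branches share their variable exactly when their truncations agree. -/
lemma integral_treeField_mul (r : OrderParameter n) (L : ℕ → ℕ) (σ τ : Config N) :
    ∫ g, treeField r L g σ * treeField r L g τ ∂(vertexMeasure n N)
      = ∑ k ∈ Finset.range n, (r.q (k + 1) - r.q k) *
        if trunc (L (k + 1)) σ = trunc (L (k + 1)) τ then 1 else 0 := by
  unfold treeField
  simp_rw [Finset.sum_mul_sum]
  have hij : ∀ (c c' : ℝ) (v w : Vertex n N),
      Integrable (fun g => c * g v * (c' * g w)) (vertexMeasure n N) := fun c c' v w => by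
    have := ((hasGaussianLaw_vertex v).memLp_two.integrable_mul
      (hasGaussianLaw_vertex w).memLp_two).const_mul (c * c')
    refine this.congr (Eventually.of_forall fun g => ?_)
    simp only [Pi.mul_apply]; ring
  have hint : ∀ (c c' : ℝ) (v w : Vertex n N),
      ∫ g, c * g v * (c' * g w) ∂(vertexMeasure n N) = c * c' * if v = w then 1 else 0 := by
    intro c c' v w
    rw [← integral_vertex_mul v w, ← integral_const_mul]
    congr 1; ext g; ring
  rw [integral_finsetSum _ fun i _ => integrable_finsetSum _ fun j _ => hij _ _ _ _,
    Finset.sum_range]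
  refine Finset.sum_congr rfl fun k _ => ?_
  rw [integral_finsetSum _ fun j _ => hij _ _ _ _]
  simp_rw [hint]
  rw [Finset.sum_eq_single k]
  · rw [Real.mul_self_sqrt (sub_nonneg.2 (r.q_lt k k.2).le)]
    simp
  · intro j _ hj
    rw [if_neg fun h => hj (congrArg Prod.fst h).symm, mul_zero]
  · simp

/-- Both fields are centered Gaussian. Because x_{k+1} N is the integer L(k+1), the condition
x_{k+1} ≤ q_L says that the initial segments of length L(k+1) agree, so the shared jumps of ϱ are
exactly the shared vertex variances. -/
theorem IsGREM.map_eq {r : OrderParameter n} {Ω : Type*} [MeasurableSpace Ω] {P : Measure Ω}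
    {Y : Config N → Ω → ℝ} (hY : IsGREM r N P Y) (hN : 0 < N) {L : ℕ → ℕ}
    (hL : ∀ k ≤ n, r.x k * N = L k) :
    P.map (fun ω σ => Y σ ω) = (vertexMeasure n N).map (treeField r L) := by
  have hlaw : HasGaussianLaw (fun ω σ => Y σ ω) P := by
    have h1 := hY.gaussian.hasGaussianLaw Finset.univ
    let T : ({σ // σ ∈ (Finset.univ : Finset (Config N))} → ℝ) →L[ℝ] (Config N → ℝ) :=
      ContinuousLinearMap.pi fun σ => ContinuousLinearMap.proj (R := ℝ)
        (φ := fun _ : {σ // σ ∈ (Finset.univ : Finset (Config N))} => ℝ) ⟨σ, Finset.mem_univ σ⟩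
    exact h1.map_fun T
  refine map_eq_map_of_covariance hlaw (hasGaussianLaw_treeField r L) hY.centered
    (integral_treeField r L) fun σ τ => ?_
  have hN' : (0 : ℝ) < N := by exact_mod_cast hN
  rw [hY.covariance, integral_treeField_mul, r.toFun_eq_sum (by unfold lexOverlap; positivity)]
  refine Finset.sum_congr rfl fun k hk => ?_
  have hk' : k + 1 ≤ n := Finset.mem_range.1 hk
  have hLN : L (k + 1) ≤ N := by
    have h1 := hL (k + 1) hk'
    have h2 := r.x_le_x hk' le_rfl
    rw [r.x_last] at h2
    have : (L (k + 1) : ℝ) ≤ N := by rw [← h1]; nlinarith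
    exact_mod_cast this
  congr 1
  refine if_congr ?_ rfl rfl
  rw [trunc_eq_trunc_iff_le_commonPrefix hLN, lexOverlap, le_div_iff₀ hN', hL _ hk']
  exact_mod_cast Iff.rfl

end GREM

namespace GREM

open scoped ENNReal

/-! ### Blocks of coordinates -/

variable {N n : ℕ}

/-- A partition of the coordinates `0, …, N - 1` into `n` consecutive blocks
`[L k, L (k + 1))`. -/
structure IsBlockPartition (n N : ℕ) (L : ℕ → ℕ) : Prop where
  zero : L 0 = 0
  last : L n = N
  mono : ∀ k < n, L k ≤ L (k + 1)

namespace IsBlockPartition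

variable {L : ℕ → ℕ} (hL : IsBlockPartition n N L)

include hL

lemma le_of_le {i j : ℕ} (hij : i ≤ j) (hj : j ≤ n) : L i ≤ L j := by
  induction j, hij using Nat.le_induction with
  | base => rfl
  | succ j hij ih => exact (ih (by omega)).trans (hL.mono j hj)

lemma le_card {k : ℕ} (hk : k ≤ n) : L k ≤ N := hL.last ▸ hL.le_of_le hk le_rfl

end IsBlockPartition

/-- The sum of `f` over the `k`-th block. -/
def blockSum (L : ℕ → ℕ) (f : Fin N → ℝ) (k : ℕ) : ℝ :=
  ∑ i : Fin N, if L k ≤ i.val ∧ i.val < L (k + 1) then f i else 0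

lemma sum_blockSum {L : ℕ → ℕ} (hL : IsBlockPartition n N L) (f : Fin N → ℝ) {K : ℕ} (hK : K ≤ n) :
    ∑ k ∈ Finset.range K, blockSum L f k = ∑ i : Fin N, if i.val < L K then f i else 0 := by
  induction K with
  | zero => simp [hL.zero]
  | succ K ih =>
    rw [Finset.sum_range_succ, ih (by omega), blockSum, ← Finset.sum_add_distrib]
    refine Finset.sum_congr rfl fun i _ => ?_
    have := hL.mono K hK
    by_cases h1 : i.val < L K
    · simp [h1, h1.trans_le this]
    · by_cases h2 : i.val < L (K + 1) <;> simp [h1, h2, not_lt.1 h1]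

lemma sum_blockSum_eq {L : ℕ → ℕ} (hL : IsBlockPartition n N L) (f : Fin N → ℝ) :
    ∑ k ∈ Finset.range n, blockSum L f k = ∑ i : Fin N, f i := by
  rw [sum_blockSum hL f le_rfl, hL.last]
  simp

lemma blockSum_const {L : ℕ → ℕ} (hL : IsBlockPartition n N L) {k : ℕ} (hk : k < n) (c : ℝ) :
    blockSum L (fun _ : Fin N => c) k = ((L (k + 1) : ℝ) - L k) * c := by
  have hcard : (Finset.univ.filter fun i : Fin N => L k ≤ i.val ∧ i.val < L (k + 1)).card
      = L (k + 1) - L k := by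
    rw [← Finset.card_map Fin.valEmbedding, ← Nat.card_Ico]
    congr 1
    ext i
    simp only [Finset.mem_map, Finset.mem_filter, Finset.mem_univ, true_and,
      Fin.valEmbedding_apply, Finset.mem_Ico]
    constructor
    · rintro ⟨i, h, rfl⟩; exact h
    · intro h
      exact ⟨⟨i, h.2.trans_le (hL.le_card hk)⟩, h, rfl⟩
  rw [blockSum, ← Finset.sum_filter, Finset.sum_const, hcard, nsmul_eq_mul,
    Nat.cast_sub (hL.mono k hk)]

lemma blockSum_congr {L : ℕ → ℕ} {f f' : Fin N → ℝ} {k : ℕ}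
    (h : ∀ i : Fin N, L k ≤ i.val → i.val < L (k + 1) → f i = f' i) :
    blockSum L f k = blockSum L f' k := by
  refine Finset.sum_congr rfl fun i _ => ?_
  split_ifs with hi
  · exact h i hi.1 hi.2
  · rfl

lemma spin_trunc {ℓ : ℕ} {i : Fin N} (hi : i.val < ℓ) (σ : Config N) :
    spin (trunc ℓ σ) i = spin σ i := by
  simp [spin, trunc, hi]

lemma blockSum_spin_trunc (L : ℕ → ℕ) (k : ℕ) (σ : Config N) :
    blockSum L (spin (trunc (L (k + 1)) σ)) k = blockSum L (spin σ) k :=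
  blockSum_congr fun _ _ hi => spin_trunc hi σ

/-- The vertices at height `k + 1` below the vertex `π` at height `k`. -/
def children (L : ℕ → ℕ) (k : ℕ) (π : Config N) : Finset (Config N) :=
  Finset.univ.filter fun π' => trunc (L k) π' = π ∧ trunc (L (k + 1)) π' = π'

lemma children_eq_piFinset {L : ℕ → ℕ} {k : ℕ} (hk : L k ≤ L (k + 1)) {π : Config N}
    (hπ : trunc (L k) π = π) : children L k π = Fintype.piFinset fun i : Fin N =>
      if i.val < L k then {π i} else if i.val < L (k + 1) then Finset.univ else {1} := by
  ext π'
  simp only [children, Finset.mem_filter, Finset.mem_univ, true_and, Fintype.mem_piFinset]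
  constructor
  · rintro ⟨h1, h2⟩ i
    split_ifs with hi hi'
    · rw [← h1]; simp [trunc, hi]
    · exact Finset.mem_univ _
    · rw [← h2]; simp [trunc, hi']
  · intro h
    constructor
    · funext i
      have := h i
      by_cases hi : i.val < L k
      · simpa [trunc, hi] using this
      · rw [← hπ]; simp [trunc, hi]
    · funext i
      have := h i
      by_cases hi' : i.val < L (k + 1)
      · simp [trunc, hi']
      · have hi : ¬ i.val < L k := fun hi => hi' (hi.trans_le hk)
        simp only [hi, hi', if_false, Finset.mem_singleton] at this
        simp [trunc, hi', this]

lemma sum_units_exp (a : ℝ) : ∑ u : ℤˣ, Real.exp (a * ((u : ℤ) : ℝ)) = 2 * Real.cosh a := by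
  have : (Finset.univ : Finset ℤˣ) = {1, -1} := by decide
  rw [this, Finset.sum_pair (by decide), Real.cosh_eq]
  simp; ring

/-- Only the coordinates of block k are free, and the sum factorizes into a factor 2 cosh a for each
of them. -/
lemma sum_children_exp {L : ℕ → ℕ} (hL : IsBlockPartition n N L) {k : ℕ} (hk : k < n)
    {π : Config N} (hπ : trunc (L k) π = π) (a : ℝ) :
    ∑ π' ∈ children L k π, Real.exp (a * blockSum L (spin π') k)
      = Real.exp (((L (k + 1) : ℝ) - L k) * Real.log (2 * Real.cosh a)) := by
  have h1 : ∀ π' : Config N, Real.exp (a * blockSum L (spin π') k)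
      = ∏ i : Fin N, if L k ≤ i.val ∧ i.val < L (k + 1) then
          Real.exp (a * ((π' i : ℤ) : ℝ)) else 1 := by
    intro π'
    rw [blockSum, Finset.mul_sum, Real.exp_sum]
    refine Finset.prod_congr rfl fun i _ => ?_
    split_ifs <;> simp [spin]
  simp_rw [h1]
  rw [children_eq_piFinset (hL.mono k hk) hπ, ← Finset.prod_univ_sum _
    (fun (i : Fin N) (u : ℤˣ) => if L k ≤ i.val ∧ i.val < L (k + 1) then
          Real.exp (a * ((u : ℤ) : ℝ)) else 1)]
  rw [← blockSum_const hL hk, blockSum, Real.exp_sum]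
  refine Finset.prod_congr rfl fun i _ => ?_
  by_cases h1 : i.val < L k
  · have : ¬ (L k ≤ i.val ∧ i.val < L (k + 1)) := fun h => absurd h.1 (not_le.2 h1)
    simp [h1, this]
  · by_cases h2 : i.val < L (k + 1)
    · simp only [not_lt.1 h1, h2, and_self, if_true, h1, if_false]
      rw [sum_units_exp, Real.exp_log (by have := Real.cosh_pos a; positivity)]
    · simp [h1, h2]

/-! ### Fractional moments of the partition function -/

/-- The Gaussian plus magnetic energy of `σ` at level `k`. -/
def levelEnergy (L : ℕ → ℕ) (c : ℕ → ℝ) (y : ℝ) (g : Vertex n N → ℝ) (σ : Config N)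
    (k : Fin n) : ℝ :=
  c k * g (k, trunc (L (k + 1)) σ) + y * blockSum L (spin σ) k

lemma levelEnergy_congr {L : ℕ → ℕ} {c : ℕ → ℝ} {y : ℝ} {g : Vertex n N → ℝ} {σ τ : Config N}
    {k : Fin n} (h : trunc (L (k + 1)) σ = trunc (L (k + 1)) τ) :
    levelEnergy L c y g σ k = levelEnergy L c y g τ k := by
  rw [levelEnergy, levelEnergy, h, ← blockSum_spin_trunc, h, blockSum_spin_trunc]

/-- The partition function of the subtree below the vertex `π` at height `k`. -/
def subtreePartition (L : ℕ → ℕ) (c : ℕ → ℝ) (y : ℝ) (k : ℕ) (π : Config N)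
    (g : Vertex n N → ℝ) : ℝ≥0∞ :=
  ∑ σ : Config N with trunc (L k) σ = π,
    ENNReal.ofReal (Real.exp (∑ j : Fin n with k ≤ j.val, levelEnergy L c y g σ j))

lemma measurable_subtreePartition (L : ℕ → ℕ) (c : ℕ → ℝ) (y : ℝ) (k : ℕ) (π : Config N) :
    Measurable (subtreePartition (n := n) L c y k π) := by
  unfold subtreePartition levelEnergy; fun_prop

/-- This separates the subtree from the variable at the vertex above it, so that independence
applies in the moment recursion. -/
lemma subtreePartition_dependsOn (L : ℕ → ℕ) (c : ℕ → ℝ) (y : ℝ) (k : ℕ) (π : Config N) :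
    DependsOn (subtreePartition (n := n) L c y k π) {v | k ≤ v.1.val} := by
  intro g g' h
  refine Finset.sum_congr rfl fun σ _ => ?_
  congr 2
  refine Finset.sum_congr rfl fun j hj => ?_
  rw [levelEnergy, levelEnergy, h]
  simpa using hj

lemma subtreePartition_last {L : ℕ → ℕ} (hL : IsBlockPartition n N L) (c : ℕ → ℝ) (y : ℝ)
    (π : Config N) (g : Vertex n N → ℝ) : subtreePartition L c y n π g = 1 := by
  have h1 : (Finset.univ.filter fun j : Fin n => n ≤ j.val) = ∅ := by
    ext j; simp
  have h2 : (Finset.univ.filter fun σ : Config N => trunc (L n) σ = π) = {π} := by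
    ext σ; simp [trunc_of_le hL.last.ge]
  simp [subtreePartition, h1, h2]

lemma subtreePartition_succ {L : ℕ → ℕ} (hL : IsBlockPartition n N L) (c : ℕ → ℝ) (y : ℝ)
    (k : Fin n) (π : Config N) (g : Vertex n N → ℝ) :
    subtreePartition L c y k π g = ∑ π' ∈ children L k π,
      ENNReal.ofReal (Real.exp (levelEnergy L c y g π' k)) *
        subtreePartition L c y (k + 1) π' g := by
  have hk := hL.mono k k.2
  have h1 : (Finset.univ.filter fun j : Fin n => k.val ≤ j.val)
      = insert k (Finset.univ.filter fun j : Fin n => k.val + 1 ≤ j.val) := by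
    ext j
    simp only [Finset.mem_filter, Finset.mem_univ, true_and, Finset.mem_insert, Fin.ext_iff]
    omega
  rw [subtreePartition, ← Finset.sum_fiberwise_of_maps_to (t := children L k π)
    (g := trunc (L (k + 1)))]
  · refine Finset.sum_congr rfl fun π' hπ' => ?_
    simp only [children, Finset.mem_filter, Finset.mem_univ, true_and] at hπ'
    rw [subtreePartition, Finset.mul_sum, Finset.filter_filter]
    have hset : (Finset.univ.filter fun σ : Config N =>
        trunc (L k) σ = π ∧ trunc (L (k + 1)) σ = π')
        = Finset.univ.filter fun σ : Config N => trunc (L (k + 1)) σ = π' := by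
      ext σ
      simp only [Finset.mem_filter, Finset.mem_univ, true_and, and_iff_right_iff_imp]
      rintro rfl
      rw [← hπ'.1, trunc_trunc, min_eq_left hk]
    rw [hset]
    refine Finset.sum_congr rfl fun σ hσ => ?_
    simp only [Finset.mem_filter, Finset.mem_univ, true_and] at hσ
    rw [h1, Finset.sum_insert (by simp), Real.exp_add, ENNReal.ofReal_mul (Real.exp_pos _).le,
      levelEnergy_congr (σ := σ) (τ := π') (by rw [hσ, hπ'.2])]
  · intro σ hσ
    simp only [Finset.mem_filter, Finset.mem_univ, true_and, children] at hσ ⊢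
    rw [trunc_trunc, trunc_trunc, min_eq_left hk, min_self]
    exact ⟨hσ, rfl⟩

/-- Functions of disjoint sets of independent coordinates are uncorrelated. -/
lemma lintegral_pi_mul_of_dependsOn {ι : Type*} [Fintype ι] {μ : ι → Measure ℝ}
    [∀ i, IsProbabilityMeasure (μ i)] {f f' : (ι → ℝ) → ℝ≥0∞} {s t : Set ι} (hst : Disjoint s t)
    (hf : Measurable f) (hf' : Measurable f') (hfs : DependsOn f s) (hft : DependsOn f' t) :
    ∫⁻ x, f x * f' x ∂(Measure.pi μ) = (∫⁻ x, f x ∂(Measure.pi μ)) * ∫⁻ x, f' x ∂(Measure.pi μ) := by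
  classical
  have hind := (iIndepFun_pi (μ := μ) (X := fun _ x => x)
    fun _ => measurable_id.aemeasurable).indepFun_finset s.toFinset t.toFinset
    (by simpa using hst) (fun i => measurable_pi_apply i)
  -- Extending by zero outside S writes a function depending only on S as a measurable function of
  -- the restricted coordinates.
  have key : ∀ (S : Finset ι), Measurable fun (z : S → ℝ) (i : ι) =>
      if h : i ∈ S then z ⟨i, h⟩ else 0 := by
    intro S
    refine measurable_pi_lambda _ fun i => ?_
    by_cases h : i ∈ S
    · simp only [h, dite_true]; fun_prop
    · simp only [h, dite_false]; fun_prop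
  have hrep : ∀ {S : Set ι} {f : (ι → ℝ) → ℝ≥0∞}, DependsOn f S →
      f = (fun z : S.toFinset → ℝ => f fun i => if h : i ∈ S.toFinset then z ⟨i, h⟩ else 0) ∘
        fun (x : ι → ℝ) (i : S.toFinset) => x i := by
    intro S f hf
    funext x
    refine hf fun i hi => ?_
    have : i ∈ S.toFinset := by simpa using hi
    simp [this]
  have h2 : IndepFun f f' (Measure.pi μ) := by
    rw [hrep hfs, hrep hft]
    exact hind.comp (hf.comp (key _)) (hf'.comp (key _))
  exact lintegral_mul_eq_lintegral_mul_lintegral_of_indepFun'' hf.aemeasurable hf'.aemeasurable h2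

lemma ENNReal_rpow_sum_le {ι : Type*} (s : Finset ι) (f : ι → ℝ≥0∞) {p : ℝ} (hp : 0 < p)
    (hp1 : p ≤ 1) : (∑ i ∈ s, f i) ^ p ≤ ∑ i ∈ s, f i ^ p :=
  Finset.le_sum_of_subadditive (fun x : ℝ≥0∞ => x ^ p) (ENNReal.zero_rpow_of_pos hp).le
    (fun x y => ENNReal.rpow_add_le_add_rpow x y hp.le hp1) s f

lemma ofReal_exp_rpow (x p : ℝ) :
    ENNReal.ofReal (Real.exp x) ^ p = ENNReal.ofReal (Real.exp (p * x)) := by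
  rw [ENNReal.ofReal_rpow_of_pos (Real.exp_pos x), ← Real.exp_mul, mul_comm]

/-- Lyapunov's inequality. -/
lemma lintegral_rpow_le_rpow {Ω : Type*} [MeasurableSpace Ω] {μ : Measure Ω}
    [IsProbabilityMeasure μ] {f : Ω → ℝ≥0∞} (hf : AEStronglyMeasurable f μ) {p m : ℝ} (hp : 0 < p)
    (hpm : p ≤ m) : ∫⁻ x, f x ^ p ∂μ ≤ (∫⁻ x, f x ^ m ∂μ) ^ (p / m) := by
  have h := eLpNorm'_le_eLpNorm'_of_exponent_le hp hpm μ hf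
  simp only [eLpNorm'_eq_lintegral_enorm, enorm_eq_self] at h
  have h2 := ENNReal.rpow_le_rpow h hp.le
  rw [← ENNReal.rpow_mul, ← ENNReal.rpow_mul, one_div_mul_cancel hp.ne', ENNReal.rpow_one] at h2
  rwa [div_mul_eq_mul_div, one_mul] at h2

lemma lintegral_exp_vertex (c : ℝ) (v : Vertex n N) :
    ∫⁻ g, ENNReal.ofReal (Real.exp (c * g v)) ∂(vertexMeasure n N)
      = ENNReal.ofReal (Real.exp (c ^ 2 / 2)) := by
  have h1 := (measurePreserving_vertex (n := n) v).lintegral_comp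
    (f := fun x => ENNReal.ofReal (Real.exp (c * x))) (by fun_prop)
  rw [h1, ← ofReal_integral_eq_lintegral_ofReal (integrable_exp_mul_gaussianReal c)
    (Eventually.of_forall fun x => (Real.exp_pos _).le)]
  have := congrFun (mgf_fun_id_gaussianReal (μ := 0) (v := 1)) c
  rw [mgf] at this
  rw [this]
  simp

/-- The exponent bounding fractional moments of the subtree partition function. -/
def momentExponent (n : ℕ) (L : ℕ → ℕ) (c : ℕ → ℝ) (y : ℝ) (m : ℕ → ℝ) (k : ℕ) : ℝ :=
  ∑ j ∈ Finset.Ico k n, (((L (j + 1) : ℝ) - L j) * Real.log (2 * Real.cosh (m j * y)) / m j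
    + m j * c j ^ 2 / 2)

/-- Backward recursion on the height. At order m_k the power is subadditive over the children, the
vertex variable is independent of the subtree below, and the spin sum is explicit; Lyapunov's
inequality then lowers the order to p. The order p varies in the induction because level k calls
level k + 1 at order m_k, not m_{k+1}. -/
theorem lintegral_subtreePartition_rpow_le {L : ℕ → ℕ} (hL : IsBlockPartition n N L) (c : ℕ → ℝ)
    (y : ℝ) {m : ℕ → ℝ} (hm0 : ∀ k < n, 0 < m k) (hm1 : ∀ k < n, m k ≤ 1)
    (hm : ∀ k, k + 1 < n → m k ≤ m (k + 1)) {k : ℕ} (hk : k ≤ n) {π : Config N}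
    (hπ : trunc (L k) π = π) {p : ℝ} (hp : 0 < p) (hpm : k < n → p ≤ m k) :
    ∫⁻ g, subtreePartition L c y k π g ^ p ∂(vertexMeasure n N)
      ≤ ENNReal.ofReal (Real.exp (p * momentExponent n L c y m k)) := by
  obtain ⟨d, hd⟩ : ∃ d, k + d = n := ⟨n - k, by omega⟩
  induction d generalizing k π p with
  | zero =>
    obtain rfl : k = n := by omega
    simp [subtreePartition_last hL, momentExponent]
  | succ d ih =>
    have hkn : k < n := by omega
    have hmk := hm0 k hkn
    have hmain : ∫⁻ g, subtreePartition L c y k π g ^ m k ∂(vertexMeasure n N)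
        ≤ ENNReal.ofReal (Real.exp (m k * momentExponent n L c y m k)) := by
      calc ∫⁻ g, subtreePartition L c y k π g ^ m k ∂(vertexMeasure n N)
          ≤ ∫⁻ g, ∑ π' ∈ children L k π,
              ENNReal.ofReal (Real.exp (m k * y * blockSum L (spin π') k)) *
              (ENNReal.ofReal (Real.exp (m k * c k * g (⟨k, hkn⟩, trunc (L (k + 1)) π'))) *
                subtreePartition L c y (k + 1) π' g ^ m k) ∂(vertexMeasure n N) := by
            refine lintegral_mono fun g => ?_
            have := subtreePartition_succ hL c y ⟨k, hkn⟩ π g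
            simp only at this
            rw [this]
            refine (ENNReal_rpow_sum_le _ _ hmk (hm1 k hkn)).trans_eq ?_
            refine Finset.sum_congr rfl fun π' _ => ?_
            rw [ENNReal.mul_rpow_of_nonneg _ _ hmk.le, ofReal_exp_rpow, ← mul_assoc,
              ← ENNReal.ofReal_mul (Real.exp_pos _).le, ← Real.exp_add, levelEnergy]
            congr 3
            ring
        _ = ∑ π' ∈ children L k π,
              ENNReal.ofReal (Real.exp (m k * y * blockSum L (spin π') k)) *
              (ENNReal.ofReal (Real.exp ((m k * c k) ^ 2 / 2)) *
                ∫⁻ g, subtreePartition L c y (k + 1) π' g ^ m k ∂(vertexMeasure n N)) := by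
            have hmeas : ∀ π', Measurable fun g : Vertex n N → ℝ =>
                subtreePartition L c y (k + 1) π' g ^ m k := fun π' =>
              (measurable_subtreePartition L c y (k + 1) π').pow_const _
            have hmeas' : ∀ π', Measurable fun g : Vertex n N → ℝ =>
                ENNReal.ofReal (Real.exp (m k * c k * g (⟨k, hkn⟩, trunc (L (k + 1)) π'))) *
                  subtreePartition L c y (k + 1) π' g ^ m k := fun π' =>
              Measurable.mul (by fun_prop) (hmeas π')
            rw [lintegral_finsetSum _ fun π' _ => (hmeas' π').const_mul _]
            refine Finset.sum_congr rfl fun π' _ => ?_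
            rw [lintegral_const_mul _ (hmeas' π'),
              ← lintegral_exp_vertex (m k * c k) (⟨k, hkn⟩, trunc (L (k + 1)) π')]
            congr 1
            refine lintegral_pi_mul_of_dependsOn (s := {(⟨k, hkn⟩, trunc (L (k + 1)) π')})
              (t := {v | k + 1 ≤ v.1.val}) ?_ (by fun_prop) (hmeas π') ?_ ?_
            · rw [Set.disjoint_singleton_left]
              simp
            · intro g g' h
              simp only [h _ rfl]
            · intro g g' h
              simp only [subtreePartition_dependsOn L c y (k + 1) π' h]
        _ ≤ ∑ π' ∈ children L k π,
              ENNReal.ofReal (Real.exp (m k * y * blockSum L (spin π') k)) *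
              (ENNReal.ofReal (Real.exp ((m k * c k) ^ 2 / 2)) *
                ENNReal.ofReal (Real.exp (m k * momentExponent n L c y m (k + 1)))) := by
            gcongr with π' hπ'
            simp only [children, Finset.mem_filter, Finset.mem_univ, true_and] at hπ'
            -- Monotonicity of m makes m_k an admissible order at the next level.
            exact ih hkn hπ'.2 hmk (fun h => hm k h) (by omega)
        _ = ENNReal.ofReal (Real.exp (m k * momentExponent n L c y m k)) := by
            rw [← Finset.sum_mul, ← ENNReal.ofReal_sum_of_nonneg fun _ _ => (Real.exp_pos _).le,
              sum_children_exp hL hkn hπ, ← ENNReal.ofReal_mul (Real.exp_pos _).le,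
              ← ENNReal.ofReal_mul (Real.exp_pos _).le, ← Real.exp_add, ← Real.exp_add]
            congr 2
            rw [momentExponent, momentExponent, Finset.sum_eq_sum_Ico_succ_bot hkn]
            field_simp
            ring
    calc ∫⁻ g, subtreePartition L c y k π g ^ p ∂(vertexMeasure n N)
        ≤ (∫⁻ g, subtreePartition L c y k π g ^ m k ∂(vertexMeasure n N)) ^ (p / m k) :=
          lintegral_rpow_le_rpow
            (measurable_subtreePartition L c y k π).aestronglyMeasurable hp (hpm hkn)
      _ ≤ ENNReal.ofReal (Real.exp (m k * momentExponent n L c y m k)) ^ (p / m k) := by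
          gcongr
      _ = ENNReal.ofReal (Real.exp (p * momentExponent n L c y m k)) := by
          rw [ofReal_exp_rpow]
          congr 2
          field_simp

end GREM

namespace GREM

/-! ### Tilted product weights on the hypercube -/

variable {N n : ℕ}

/-- The probability of the spin value `u` with exponential tilt `y`. -/
def spinWeight (y : ℝ) (u : ℤˣ) : ℝ := Real.exp (y * ((u : ℤ) : ℝ)) / (2 * Real.cosh y)

lemma spinWeight_pos (y : ℝ) (u : ℤˣ) : 0 < spinWeight y u := by
  have := Real.cosh_pos y
  unfold spinWeight; positivity

lemma spinWeight_eq_exp (y : ℝ) (u : ℤˣ) :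
    spinWeight y u = Real.exp (y * ((u : ℤ) : ℝ) - Real.log (2 * Real.cosh y)) := by
  have := Real.cosh_pos y
  rw [spinWeight, Real.exp_sub, Real.exp_log (by positivity)]

lemma sum_units (f : ℤˣ → ℝ) : ∑ u, f u = f 1 + f (-1) := by
  have : (Finset.univ : Finset ℤˣ) = {1, -1} := by decide
  rw [this, Finset.sum_pair (by decide)]

lemma sum_spinWeight (y : ℝ) : ∑ u, spinWeight y u = 1 := by
  have := Real.cosh_pos y
  simp only [spinWeight]
  rw [← Finset.sum_div, sum_units_exp, div_self (by positivity)]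

lemma sum_spinWeight_mul_sub (y : ℝ) :
    ∑ u : ℤˣ, spinWeight y u * (((u : ℤ) : ℝ) - Real.tanh y) = 0 := by
  have := Real.cosh_pos y
  rw [sum_units, spinWeight, spinWeight, Real.tanh_eq_sinh_div_cosh]
  simp only [Units.val_one, Int.cast_one, Units.val_neg, Int.cast_neg, mul_one, mul_neg]
  field_simp
  rw [Real.cosh_eq, Real.sinh_eq]
  ring

lemma sum_spinWeight_mul_sub_sq (y : ℝ) :
    ∑ u : ℤˣ, spinWeight y u * (((u : ℤ) : ℝ) - Real.tanh y) ^ 2 ≤ 1 := by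
  have h1 := sum_spinWeight y
  have h2 := sum_spinWeight_mul_sub y
  rw [sum_units] at *
  simp only [Units.val_one, Int.cast_one, Units.val_neg, Int.cast_neg] at *
  have : spinWeight y 1 * (1 - Real.tanh y) ^ 2 + spinWeight y (-1) * (-1 - Real.tanh y) ^ 2
      = 1 - Real.tanh y ^ 2 := by
    linear_combination (-2 * Real.tanh y) * h2 + (1 - Real.tanh y ^ 2) * h1
  rw [this]
  nlinarith [sq_nonneg (Real.tanh y)]

/-- The product weight with tilt `y i` at the `i`-th coordinate. -/
def configWeight (y : Fin N → ℝ) (σ : Config N) : ℝ := ∏ i, spinWeight (y i) (σ i)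

/-- The weight of the initial segment of length `ℓ`. -/
def prefixWeight (y : Fin N → ℝ) (ℓ : ℕ) (σ : Config N) : ℝ :=
  ∏ i, if i.val < ℓ then spinWeight (y i) (σ i) else 1

lemma configWeight_pos (y : Fin N → ℝ) (σ : Config N) : 0 < configWeight y σ :=
  Finset.prod_pos fun _ _ => spinWeight_pos _ _

lemma prefixWeight_of_le {ℓ : ℕ} (h : N ≤ ℓ) (y : Fin N → ℝ) (σ : Config N) :
    prefixWeight y ℓ σ = configWeight y σ :=
  Finset.prod_congr rfl fun i _ => if_pos (i.isLt.trans_le h)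

lemma prefixWeight_eq_exp (y : Fin N → ℝ) (ℓ : ℕ) (σ : Config N) :
    prefixWeight y ℓ σ = Real.exp (∑ i : Fin N, if i.val < ℓ then
      y i * spin σ i - Real.log (2 * Real.cosh (y i)) else 0) := by
  rw [prefixWeight, Real.exp_sum]
  refine Finset.prod_congr rfl fun i _ => ?_
  split_ifs
  · exact spinWeight_eq_exp _ _
  · simp

lemma sum_configWeight_of_trunc_eq (y : Fin N → ℝ) (ℓ : ℕ) (σ : Config N) :
    ∑ τ : Config N with trunc ℓ τ = trunc ℓ σ, configWeight y τ = prefixWeight y ℓ σ := by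
  have hset : (Finset.univ.filter fun τ : Config N => trunc ℓ τ = trunc ℓ σ)
      = Fintype.piFinset fun i : Fin N => if i.val < ℓ then {σ i} else Finset.univ := by
    ext τ
    simp only [Finset.mem_filter, Finset.mem_univ, true_and, Fintype.mem_piFinset,
      trunc_eq_trunc_iff]
    refine forall_congr' fun i => ?_
    split_ifs with hi
    · simp [hi]
    · exact ⟨fun _ => Finset.mem_univ _, fun _ h => absurd h hi⟩
  rw [hset]
  simp only [configWeight]
  rw [← Finset.prod_univ_sum _ (fun (i : Fin N) (u : ℤˣ) => spinWeight (y i) u), prefixWeight]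
  refine Finset.prod_congr rfl fun i _ => ?_
  split_ifs
  · simp
  · exact sum_spinWeight _

lemma sum_configWeight (y : Fin N → ℝ) : ∑ σ : Config N, configWeight y σ = 1 := by
  have := sum_configWeight_of_trunc_eq y 0 1
  simpa [trunc_zero, prefixWeight] using this

/-- Under the product weight distinct centered spins are uncorrelated, and each has variance 1 -
tanh² ≤ 1. -/
lemma sum_configWeight_mul_mul (y : Fin N → ℝ) (i j : Fin N) :
    ∑ σ : Config N, configWeight y σ *
      ((spin σ i - Real.tanh (y i)) * (spin σ j - Real.tanh (y j))) ≤ if i = j then 1 else 0 := by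
  have key : ∀ σ : Config N, configWeight y σ *
      ((spin σ i - Real.tanh (y i)) * (spin σ j - Real.tanh (y j)))
      = ∏ l, (spinWeight (y l) (σ l) * ((if l = i then ((σ l : ℤ) : ℝ) - Real.tanh (y l) else 1) *
          (if l = j then ((σ l : ℤ) : ℝ) - Real.tanh (y l) else 1))) := by
    intro σ
    rw [Finset.prod_mul_distrib, Finset.prod_mul_distrib, Finset.prod_ite_eq', Finset.prod_ite_eq']
    simp [configWeight, spin]
  simp_rw [key]
  rw [← Fintype.prod_sum (fun (l : Fin N) (u : ℤˣ) => spinWeight (y l) u *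
    ((if l = i then ((u : ℤ) : ℝ) - Real.tanh (y l) else 1) *
          (if l = j then ((u : ℤ) : ℝ) - Real.tanh (y l) else 1)))]
  split_ifs with hij
  · subst hij
    refine Finset.prod_le_one (fun l _ => Finset.sum_nonneg fun u _ => ?_) fun l _ => ?_
    · split_ifs <;> nlinarith [spinWeight_pos (y l) u,
        mul_nonneg (spinWeight_pos (y l) u).le (mul_self_nonneg (((u : ℤ) : ℝ) - Real.tanh (y l)))]
    · by_cases h : l = i
      · simp only [h, if_true, ← pow_two]
        exact sum_spinWeight_mul_sub_sq _
      · simp only [h, if_false, mul_one]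
        exact (sum_spinWeight _).le
  · refine (Finset.prod_eq_zero (Finset.mem_univ i) ?_).le
    simp only [hij, if_true, if_false, mul_one]
    exact sum_spinWeight_mul_sub _

lemma sum_configWeight_blockSum_sq_le (y : Fin N → ℝ) (L : ℕ → ℕ) (k : ℕ) :
    ∑ σ : Config N, configWeight y σ *
      (blockSum L (fun i => spin σ i - Real.tanh (y i)) k) ^ 2 ≤ N := by
  set b : Fin N → ℝ := fun i => if L k ≤ i.val ∧ i.val < L (k + 1) then 1 else 0 with hb
  have hb0 : ∀ i, 0 ≤ b i := fun i => by rw [hb]; dsimp only; split_ifs <;> norm_num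
  have hb1 : ∀ i, b i ≤ 1 := fun i => by rw [hb]; dsimp only; split_ifs <;> norm_num
  have h1 : ∀ σ : Config N, blockSum L (fun i => spin σ i - Real.tanh (y i)) k
      = ∑ i, b i * (spin σ i - Real.tanh (y i)) := by
    intro σ
    refine Finset.sum_congr rfl fun i _ => ?_
    rw [hb]; dsimp only; split_ifs <;> simp
  simp_rw [h1, pow_two, Finset.sum_mul_sum, Finset.mul_sum]
  rw [Finset.sum_comm]
  calc ∑ i, ∑ σ : Config N, ∑ j, configWeight y σ * (b i * (spin σ i - Real.tanh (y i)) *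
        (b j * (spin σ j - Real.tanh (y j))))
      = ∑ i, ∑ j, b i * b j * ∑ σ : Config N, configWeight y σ *
          ((spin σ i - Real.tanh (y i)) * (spin σ j - Real.tanh (y j))) := by
        refine Finset.sum_congr rfl fun i _ => ?_
        rw [Finset.sum_comm]
        refine Finset.sum_congr rfl fun j _ => ?_
        rw [Finset.mul_sum]
        refine Finset.sum_congr rfl fun σ _ => ?_
        ring
    _ ≤ ∑ i, ∑ j, b i * b j * if i = j then 1 else 0 := by
        refine Finset.sum_le_sum fun i _ => Finset.sum_le_sum fun j _ => ?_
        exact mul_le_mul_of_nonneg_left (sum_configWeight_mul_mul y i j)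
          (mul_nonneg (hb0 i) (hb0 j))
    _ = ∑ i, b i * b i := by simp
    _ ≤ ∑ i : Fin N, 1 := by
        refine Finset.sum_le_sum fun i _ => ?_
        nlinarith [hb0 i, hb1 i]
    _ = N := by simp

open Classical in
/-- The configurations whose block magnetizations are close to their tilted means. -/
def typicalConfigs (n : ℕ) (L : ℕ → ℕ) (y : Fin N → ℝ) (ε : ℝ) : Finset (Config N) :=
  Finset.univ.filter fun σ =>
    ∀ k < n, |blockSum L (fun i => spin σ i - Real.tanh (y i)) k| ≤ ε

/-- Chebyshev's inequality with a union bound over the n blocks: the weight of an atypical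
configuration is dominated by the quadratic term of a block that deviates. -/
lemma sum_typicalConfigs_ge (n : ℕ) (L : ℕ → ℕ) (y : Fin N → ℝ) {ε : ℝ} (hε : 0 < ε) :
    1 - n * (N / ε ^ 2) ≤ ∑ σ ∈ typicalConfigs n L y ε, configWeight y σ := by
  classical
  have h1 : ∀ σ : Config N, configWeight y σ ≤
      (if σ ∈ typicalConfigs n L y ε then configWeight y σ else 0) +
      ∑ k ∈ Finset.range n, configWeight y σ *
        (blockSum L (fun i => spin σ i - Real.tanh (y i)) k) ^ 2 / ε ^ 2 := by
    intro σ
    have hpos := configWeight_pos y σ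
    have hnn : ∀ k, 0 ≤ configWeight y σ *
        (blockSum L (fun i => spin σ i - Real.tanh (y i)) k) ^ 2 / ε ^ 2 := fun k => by positivity
    split_ifs with hσ
    · have := Finset.sum_nonneg fun k (_ : k ∈ Finset.range n) => hnn k
      linarith
    · simp only [typicalConfigs, Finset.mem_filter, Finset.mem_univ, true_and] at hσ
      push Not at hσ
      obtain ⟨k, hk, hlt⟩ := hσ
      rw [zero_add]
      refine le_trans ?_ (Finset.single_le_sum (fun k _ => hnn k) (Finset.mem_range.2 hk))
      rw [le_div_iff₀ (by positivity)]
      refine mul_le_mul_of_nonneg_left ?_ hpos.le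
      rw [← sq_abs (blockSum _ _ _)]
      gcongr
  have h2 := Finset.sum_le_sum fun σ (_ : σ ∈ (Finset.univ : Finset (Config N))) => h1 σ
  rw [sum_configWeight, Finset.sum_add_distrib, Finset.sum_comm, Finset.sum_ite_mem,
    Finset.univ_inter] at h2
  have h3 : ∑ k ∈ Finset.range n, ∑ σ : Config N, configWeight y σ *
        (blockSum L (fun i => spin σ i - Real.tanh (y i)) k) ^ 2 / ε ^ 2 ≤ n * (N / ε ^ 2) := by
    calc _ ≤ ∑ k ∈ Finset.range n, (N / ε ^ 2 : ℝ) := by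
          refine Finset.sum_le_sum fun k _ => ?_
          rw [← Finset.sum_div]
          gcongr
          exact sum_configWeight_blockSum_sq_le y L k
      _ = _ := by simp
  linarith

/-! ### Second moment method -/

/-- The event that all vertex variables along the branch `σ` exceed their thresholds. -/
def branchEvent (n : ℕ) (L : ℕ → ℕ) (v : ℕ → ℝ) (σ : Config N) : Set (Vertex n N → ℝ) :=
  {g | ∀ k : Fin n, v k ≤ g (k, trunc (L (k + 1)) σ)}

/-- The standard Gaussian tail probability. -/
def gaussTail (v : ℝ) : ℝ := (gaussianReal 0 1).real (Set.Ici v)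

lemma measurableSet_branchEvent (L : ℕ → ℕ) (v : ℕ → ℝ) (σ : Config N) :
    MeasurableSet (branchEvent n L v σ) := by
  unfold branchEvent
  rw [Set.ofPred_forall]
  exact MeasurableSet.iInter fun k => measurableSet_le measurable_const (measurable_pi_apply _)

/-- The joint event is a box in the product space; a shared vertex is constrained once, two distinct
vertices independently. -/
lemma measureReal_branchEvent_inter (L : ℕ → ℕ) (v : ℕ → ℝ) (σ τ : Config N) :
    (vertexMeasure n N).real (branchEvent n L v σ ∩ branchEvent n L v τ)
      = ∏ k ∈ Finset.range n, if trunc (L (k + 1)) σ = trunc (L (k + 1)) τ then gaussTail (v k)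
          else gaussTail (v k) ^ 2 := by
  classical
  have hset : branchEvent n L v σ ∩ branchEvent n L v τ
      = Set.univ.pi fun w : Vertex n N =>
        if w.2 ∈ ({trunc (L (w.1 + 1)) σ, trunc (L (w.1 + 1)) τ} : Finset (Config N)) then
          Set.Ici (v w.1) else Set.univ := by
    ext g
    simp only [branchEvent, Set.mem_inter_iff, Set.mem_ofPred_eq, Set.mem_pi, Set.mem_univ,
      true_implies, Finset.mem_insert, Finset.mem_singleton]
    constructor
    · rintro ⟨h1, h2⟩ ⟨k, π⟩
      split_ifs with h
      · rcases h with h | h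
        · simp only at h; subst h; exact h1 k
        · simp only at h; subst h; exact h2 k
      · trivial
    · intro h
      refine ⟨fun k => ?_, fun k => ?_⟩
      · have := h (k, trunc (L (k + 1)) σ)
        simpa using this
      · have := h (k, trunc (L (k + 1)) τ)
        simpa using this
  rw [hset, measureReal_def, vertexMeasure, Measure.pi_pi, ENNReal.toReal_prod,
    Fintype.prod_prod_type, Finset.prod_range]
  refine Finset.prod_congr rfl fun k _ => ?_
  have h1 : ∀ π : Config N, (gaussianReal 0 1
      (if π ∈ ({trunc (L (k + 1)) σ, trunc (L (k + 1)) τ} : Finset (Config N)) then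
          Set.Ici (v k) else Set.univ)).toReal
      = if π ∈ ({trunc (L (k + 1)) σ, trunc (L (k + 1)) τ} : Finset (Config N)) then
          gaussTail (v k) else 1 := by
    intro π
    split_ifs
    · rfl
    · simp
  simp only [h1]
  rw [Finset.prod_ite_mem, Finset.univ_inter, Finset.prod_const]
  split_ifs with h
  · simp [h]
  · rw [Finset.card_pair h]

/-- Pair correlations are controlled by the overlap. -/
lemma prod_ite_le {p : ℕ → ℝ} {e : ℕ → Prop} [DecidablePred e] (hp : ∀ k < n, 0 < p k)
    (he : ∀ i j, i ≤ j → j < n → e j → e i) :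
    ∏ k ∈ Finset.range n, (if e k then p k else p k ^ 2)
      ≤ (∏ k ∈ Finset.range n, p k) ^ 2 * (1 + ∑ K ∈ Finset.range n,
          if e K then ∏ k ∈ Finset.range (K + 1), (p k)⁻¹ else 0) := by
  induction n with
  | zero => simp
  | succ n ih =>
    have hP : 0 < ∏ k ∈ Finset.range n, p k :=
      Finset.prod_pos fun k hk => hp k (by have := Finset.mem_range.1 hk; omega)
    have hS : 0 ≤ ∑ K ∈ Finset.range n,
          if e K then ∏ k ∈ Finset.range (K + 1), (p k)⁻¹ else 0 := by
      refine Finset.sum_nonneg fun K hK => ?_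
      split_ifs
      · refine Finset.prod_nonneg fun k hk => (inv_pos.2 (hp k ?_)).le
        have := Finset.mem_range.1 hk
        have := Finset.mem_range.1 hK
        omega
      · rfl
    have hpn := hp n (Nat.lt_succ_self n)
    -- If the last level agrees then all do, and the product P equals P² P⁻¹, which is the last
    -- summand. Otherwise the last level contributes its square on both sides.
    by_cases hn : e n
    · have hall : ∏ k ∈ Finset.range (n + 1), (if e k then p k else p k ^ 2)
          = ∏ k ∈ Finset.range (n + 1), p k := by
        refine Finset.prod_congr rfl fun k hk => if_pos ?_
        exact he k n (by have := Finset.mem_range.1 hk; omega) (Nat.lt_succ_self n) hn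
      have hP' : 0 < ∏ k ∈ Finset.range (n + 1), p k := by
        rw [Finset.prod_range_succ]; positivity
      rw [hall, Finset.sum_range_succ, if_pos hn, Finset.prod_inv_distrib]
      have : (∏ k ∈ Finset.range (n + 1), p k) ^ 2 * (∏ k ∈ Finset.range (n + 1), p k)⁻¹
          = ∏ k ∈ Finset.range (n + 1), p k := by field_simp
      nlinarith [mul_nonneg (sq_nonneg (∏ k ∈ Finset.range (n + 1), p k)) hS,
        sq_nonneg (∏ k ∈ Finset.range (n + 1), p k)]
    · have := ih (fun k hk => hp k (by omega)) (fun i j hij hj => he i j hij (by omega))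
      rw [Finset.prod_range_succ, Finset.prod_range_succ, Finset.sum_range_succ, if_neg hn,
        if_neg hn, add_zero, mul_pow, mul_right_comm]
      exact mul_le_mul_of_nonneg_right this (sq_nonneg _)

/-- The weight of the typical branches along which all vertex variables are large. -/
def branchMass (L : ℕ → ℕ) (v : ℕ → ℝ) (y : Fin N → ℝ) (M : Finset (Config N))
    (g : Vertex n N → ℝ) : ℝ :=
  ∑ σ ∈ M, configWeight y σ * (branchEvent n L v σ).indicator 1 g

lemma measurable_branchMass (L : ℕ → ℕ) (v : ℕ → ℝ) (y : Fin N → ℝ) (M : Finset (Config N)) :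
    Measurable (branchMass (n := n) L v y M) := by
  unfold branchMass
  refine Finset.measurable_sum _ fun σ _ => Measurable.const_mul ?_ _
  exact (measurable_const (a := (1 : ℝ))).indicator (measurableSet_branchEvent L v σ)

lemma memLp_branchMass (L : ℕ → ℕ) (v : ℕ → ℝ) (y : Fin N → ℝ) (M : Finset (Config N)) :
    MemLp (branchMass (n := n) L v y M) 2 (vertexMeasure n N) := by
  refine MemLp.of_bound (measurable_branchMass L v y M).aestronglyMeasurable
    (∑ σ ∈ M, configWeight y σ) (Eventually.of_forall fun g => ?_)
  refine (norm_sum_le _ _).trans (Finset.sum_le_sum fun σ _ => ?_)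
  rw [norm_mul, Real.norm_of_nonneg (configWeight_pos y σ).le]
  refine mul_le_of_le_one_right (configWeight_pos y σ).le ?_
  by_cases h : g ∈ branchEvent n L v σ <;> simp [h]

lemma integral_branchMass (L : ℕ → ℕ) (v : ℕ → ℝ) (y : Fin N → ℝ) (M : Finset (Config N)) :
    ∫ g, branchMass (n := n) L v y M g ∂(vertexMeasure n N)
      = (∑ σ ∈ M, configWeight y σ) * ∏ k ∈ Finset.range n, gaussTail (v k) := by
  unfold branchMass
  rw [integral_finsetSum, Finset.sum_mul]
  · refine Finset.sum_congr rfl fun σ _ => ?_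
    rw [integral_const_mul, integral_indicator_one (measurableSet_branchEvent L v σ)]
    have := measureReal_branchEvent_inter (n := n) L v σ σ
    rw [Set.inter_self] at this
    rw [this]
    simp
  · intro σ _
    exact ((integrable_const (1 : ℝ)).indicator (measurableSet_branchEvent L v σ)).const_mul _

lemma integral_branchMass_sq (L : ℕ → ℕ) (v : ℕ → ℝ) (y : Fin N → ℝ) (M : Finset (Config N)) :
    ∫ g, branchMass (n := n) L v y M g ^ 2 ∂(vertexMeasure n N)
      = ∑ σ ∈ M, ∑ τ ∈ M, configWeight y σ * configWeight y τ *
        ∏ k ∈ Finset.range n, if trunc (L (k + 1)) σ = trunc (L (k + 1)) τ then gaussTail (v k)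
          else gaussTail (v k) ^ 2 := by
  have h1 : ∀ g, branchMass (n := n) L v y M g ^ 2 = ∑ σ ∈ M, ∑ τ ∈ M,
      configWeight y σ * configWeight y τ *
        (branchEvent n L v σ ∩ branchEvent n L v τ).indicator 1 g := by
    intro g
    rw [branchMass, pow_two, Finset.sum_mul_sum]
    refine Finset.sum_congr rfl fun σ _ => Finset.sum_congr rfl fun τ _ => ?_
    rw [Set.inter_indicator_one, Pi.mul_apply]
    ring
  have hmeas : ∀ σ τ : Config N, MeasurableSet (branchEvent n L v σ ∩ branchEvent n L v τ) :=
    fun σ τ => (measurableSet_branchEvent L v σ).inter (measurableSet_branchEvent L v τ)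
  have hint : ∀ σ τ : Config N, Integrable (fun g => configWeight y σ * configWeight y τ *
        (branchEvent n L v σ ∩ branchEvent n L v τ).indicator 1 g) (vertexMeasure n N) :=
    fun σ τ => ((integrable_const (1 : ℝ)).indicator (hmeas σ τ)).const_mul _
  simp_rw [h1]
  rw [integral_finsetSum _ fun σ _ => integrable_finsetSum _ fun τ _ => hint σ τ]
  refine Finset.sum_congr rfl fun σ _ => ?_
  rw [integral_finsetSum _ fun τ _ => hint σ τ]
  refine Finset.sum_congr rfl fun τ _ => ?_
  rw [integral_const_mul, integral_indicator_one (hmeas σ τ), measureReal_branchEvent_inter]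

/-- In the bound `prod_ite_le`, the summand 1 reproduces the squared mean and cancels. What remains
pairs σ with the τ sharing its initial segment, whose total weight is at most `prefixWeight`. -/
lemma variance_branchMass_le {L : ℕ → ℕ} (hL : IsBlockPartition n N L) {v : ℕ → ℝ}
    (hv : ∀ k < n, 0 < gaussTail (v k)) (y : Fin N → ℝ) (M : Finset (Config N)) {A : ℕ → ℝ}
    (hA : ∀ σ ∈ M, ∀ K < n, prefixWeight y (L (K + 1)) σ ≤ A K) :
    Var[branchMass (n := n) L v y M; vertexMeasure n N]
      ≤ (∏ k ∈ Finset.range n, gaussTail (v k)) ^ 2 * ((∑ σ ∈ M, configWeight y σ) *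
        ∑ K ∈ Finset.range n, A K * ∏ k ∈ Finset.range (K + 1), (gaussTail (v k))⁻¹) := by
  rw [variance_eq_sub (memLp_branchMass L v y M)]
  simp only [Pi.pow_apply]
  rw [integral_branchMass_sq, integral_branchMass]
  set P := ∏ k ∈ Finset.range n, gaussTail (v k) with hP
  set R : ℕ → ℝ := fun K => ∏ k ∈ Finset.range (K + 1), (gaussTail (v k))⁻¹ with hR
  have hR0 : ∀ K < n, 0 ≤ R K := by
    intro K hK
    refine Finset.prod_nonneg fun k hk => (inv_pos.2 (hv k ?_)).le
    have := Finset.mem_range.1 hk; omega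
  have hw := fun σ => (configWeight_pos y σ).le
  have step1 : ∑ σ ∈ M, ∑ τ ∈ M, configWeight y σ * configWeight y τ *
        (∏ k ∈ Finset.range n, if trunc (L (k + 1)) σ = trunc (L (k + 1)) τ then gaussTail (v k)
          else gaussTail (v k) ^ 2)
      ≤ ∑ σ ∈ M, ∑ τ ∈ M, configWeight y σ * configWeight y τ * (P ^ 2 *
        (1 + ∑ K ∈ Finset.range n, if trunc (L (K + 1)) σ = trunc (L (K + 1)) τ then R K else 0)) := by
    refine Finset.sum_le_sum fun σ _ => Finset.sum_le_sum fun τ _ => ?_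
    refine mul_le_mul_of_nonneg_left ?_ (mul_nonneg (hw σ) (hw τ))
    exact prod_ite_le (p := fun k => gaussTail (v k)) hv fun i j hij hj h =>
      trunc_eq_trunc_of_le (hL.le_of_le (by omega) (by omega)) h
  have step2 : ∑ σ ∈ M, ∑ τ ∈ M, configWeight y σ * configWeight y τ * (P ^ 2 *
        (1 + ∑ K ∈ Finset.range n, if trunc (L (K + 1)) σ = trunc (L (K + 1)) τ then R K else 0))
      = (∑ σ ∈ M, configWeight y σ) ^ 2 * P ^ 2 + P ^ 2 * ∑ σ ∈ M, configWeight y σ *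
        ∑ K ∈ Finset.range n, R K * ∑ τ ∈ M with trunc (L (K + 1)) τ = trunc (L (K + 1)) σ,
          configWeight y τ := by
    rw [pow_two (∑ σ ∈ M, configWeight y σ), Finset.sum_mul_sum, Finset.sum_mul, Finset.mul_sum,
      ← Finset.sum_add_distrib]
    refine Finset.sum_congr rfl fun σ _ => ?_
    have e1 : ∑ K ∈ Finset.range n, R K * ∑ τ ∈ M with trunc (L (K + 1)) τ = trunc (L (K + 1)) σ,
          configWeight y τ = ∑ τ ∈ M, configWeight y τ * ∑ K ∈ Finset.range n,
            if trunc (L (K + 1)) σ = trunc (L (K + 1)) τ then R K else 0 := by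
      simp_rw [Finset.mul_sum]
      rw [Finset.sum_comm]
      refine Finset.sum_congr rfl fun K _ => ?_
      rw [Finset.sum_filter]
      refine Finset.sum_congr rfl fun τ _ => ?_
      by_cases h : trunc (L (K + 1)) σ = trunc (L (K + 1)) τ
      · rw [if_pos h, if_pos h.symm, mul_comm]
      · rw [if_neg h, if_neg fun h' => h h'.symm, mul_zero]
    rw [e1, Finset.mul_sum, Finset.mul_sum, Finset.sum_mul, ← Finset.sum_add_distrib]
    refine Finset.sum_congr rfl fun τ _ => ?_
    ring
  have step3 : ∑ σ ∈ M, configWeight y σ *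
        ∑ K ∈ Finset.range n, R K * ∑ τ ∈ M with trunc (L (K + 1)) τ = trunc (L (K + 1)) σ,
          configWeight y τ ≤ (∑ σ ∈ M, configWeight y σ) * ∑ K ∈ Finset.range n, A K * R K := by
    rw [Finset.sum_mul]
    refine Finset.sum_le_sum fun σ hσ => mul_le_mul_of_nonneg_left ?_ (hw σ)
    refine Finset.sum_le_sum fun K hK => ?_
    have hKn := Finset.mem_range.1 hK
    rw [mul_comm]
    refine mul_le_mul_of_nonneg_right ?_ (hR0 K hKn)
    refine le_trans ?_ (hA σ hσ K hKn)
    rw [← sum_configWeight_of_trunc_eq]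
    exact Finset.sum_le_sum_of_subset_of_nonneg
      (Finset.filter_subset_filter _ (Finset.subset_univ M)) fun τ _ _ => hw τ
  have step4 := mul_le_mul_of_nonneg_left step3 (sq_nonneg P)
  rw [step2] at step1
  nlinarith

/-- With overwhelming probability the branch mass is at least a quarter of its typical value. -/
theorem measure_branchMass_lt_le {L : ℕ → ℕ} (hL : IsBlockPartition n N L) {v : ℕ → ℝ}
    (hv : ∀ k < n, 0 < gaussTail (v k)) (y : Fin N → ℝ) (M : Finset (Config N)) {A : ℕ → ℝ}
    (hA : ∀ σ ∈ M, ∀ K < n, prefixWeight y (L (K + 1)) σ ≤ A K)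
    (hM : 1 / 2 ≤ ∑ σ ∈ M, configWeight y σ) :
    vertexMeasure n N {g | branchMass L v y M g < 1 / 4 * ∏ k ∈ Finset.range n, gaussTail (v k)}
      ≤ ENNReal.ofReal (8 * ∑ K ∈ Finset.range n, A K *
          ∏ k ∈ Finset.range (K + 1), (gaussTail (v k))⁻¹) := by
  set P := ∏ k ∈ Finset.range n, gaussTail (v k) with hP
  set w := ∑ σ ∈ M, configWeight y σ with hw
  set S := ∑ K ∈ Finset.range n, A K * ∏ k ∈ Finset.range (K + 1), (gaussTail (v k))⁻¹ with hS
  have hP0 : 0 < P := Finset.prod_pos fun k hk => hv k (Finset.mem_range.1 hk)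
  -- Chebyshev's inequality at half the mean wP: a mass below P/4 lies at or below wP/2, because w ≥
  -- 1/2.
  have hc : 0 < 1 / 2 * (w * P) := by positivity
  have hvar := variance_branchMass_le hL hv y M hA
  have hcheb := meas_ge_le_variance_div_sq (memLp_branchMass (n := n) L v y M) hc
  rw [integral_branchMass] at hcheb
  refine (measure_mono fun g hg => ?_).trans (hcheb.trans (ENNReal.ofReal_le_ofReal ?_))
  · simp only [Set.mem_ofPred_eq] at hg ⊢
    rw [le_abs]
    right
    nlinarith
  · rw [← hP, ← hw, ← hS] at hvar
    rw [div_le_iff₀ (by positivity)]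
    have hS0 : 0 ≤ w * S := by
      have h1 := (variance_nonneg (branchMass (n := n) L v y M) (vertexMeasure n N)).trans hvar
      exact nonneg_of_mul_nonneg_right h1 (by positivity)
    have hS1 : 0 ≤ S := nonneg_of_mul_nonneg_right hS0 (by linarith)
    refine hvar.trans ?_
    -- The variance bound P²wS divided by (wP/2)² is 4S/w, at most 8S.
    have : 8 * S * (1 / 2 * (w * P)) ^ 2 = P ^ 2 * (w * S) * (2 * w) := by ring
    rw [this]
    have h2 : 0 ≤ P ^ 2 * (w * S) := by positivity
    nlinarith

/-- The density is smallest at the right end of [v, v + 1], and its normalization 1/√(2π) is at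
least e⁻¹. -/
lemma le_gaussTail {v : ℝ} (hv : 0 ≤ v) :
    Real.exp (-((v + 1) ^ 2 / 2) - 1) ≤ gaussTail v := by
  have hsub : ENNReal.ofReal (Real.exp (-((v + 1) ^ 2 / 2) - 1))
      ≤ gaussianReal 0 1 (Set.Icc v (v + 1)) := by
    rw [gaussianReal_apply 0 one_ne_zero]
    calc ENNReal.ofReal (Real.exp (-((v + 1) ^ 2 / 2) - 1))
        = ∫⁻ _ in Set.Icc v (v + 1), ENNReal.ofReal (Real.exp (-((v + 1) ^ 2 / 2) - 1)) := by
          simp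
      _ ≤ _ := by
          refine setLIntegral_mono' measurableSet_Icc fun x hx => ?_
          rw [gaussianPDF]
          refine ENNReal.ofReal_le_ofReal ?_
          rw [gaussianPDFReal_def]
          have hpi : √(2 * Real.pi) ≤ Real.exp 1 := by
            rw [Real.sqrt_le_left (Real.exp_pos 1).le]
            have h1 := Real.pi_lt_d2
            have h2 := Real.exp_one_gt_d9
            nlinarith
          have hpi0 : 0 < √(2 * Real.pi) := Real.sqrt_pos.2 (by positivity)
          simp only [NNReal.coe_one, mul_one, sub_zero]
          rw [sub_eq_add_neg, Real.exp_add, mul_comm]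
          refine mul_le_mul ?_ ?_ (Real.exp_pos _).le (inv_pos.2 hpi0).le
          · rw [Real.exp_neg]
            exact inv_anti₀ hpi0 hpi
          · refine Real.exp_le_exp.2 ?_
            have := hx.1
            have := hx.2
            nlinarith
  have h2 := hsub.trans (measure_mono (Set.Icc_subset_Ici_self))
  rw [gaussTail, measureReal_def]
  exact (ENNReal.ofReal_le_iff_le_toReal (measure_ne_top _ _)).1 h2

end GREM

namespace GREM

/-! ### Bounds on the free energy of the tree field -/

variable {N n : ℕ}

namespace OrderParameter

variable (r : OrderParameter n)

include r in
lemma pos : 0 < n := by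
  rcases Nat.eq_zero_or_pos n with rfl | h
  · have h0 := r.x_zero
    have h1 := r.x_last
    linarith
  · exact h

lemma isBlockPartition {L : ℕ → ℕ} (hL : ∀ k ≤ n, r.x k * N = L k) : IsBlockPartition n N L where
  zero := by
    have := hL 0 (Nat.zero_le n)
    rw [r.x_zero, zero_mul] at this
    exact_mod_cast this.symm
  last := by
    have := hL n le_rfl
    rw [r.x_last, one_mul] at this
    exact_mod_cast this.symm
  mono k hk := by
    have h1 := hL k hk.le
    have h2 := hL (k + 1) hk
    have : (L k : ℝ) ≤ L (k + 1) := by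
      rw [← h1, ← h2]
      exact mul_le_mul_of_nonneg_right (r.x_lt k hk).le (Nat.cast_nonneg N)
    exact_mod_cast this

lemma block_length {L : ℕ → ℕ} (hL : ∀ k ≤ n, r.x k * N = L k) {k : ℕ} (hk : k < n) :
    (L (k + 1) : ℝ) - L k = N * (r.x (k + 1) - r.x k) := by
  rw [← hL k hk.le, ← hL (k + 1) hk]; ring

end OrderParameter

lemma partitionFunction_pos (β h : ℝ) (u : Config N → ℝ) : 0 < partitionFunction β h u :=
  Finset.sum_pos (fun _ _ => Real.exp_pos _) Finset.univ_nonempty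

lemma exp_mul_freeEnergy (hN : 0 < N) (β h : ℝ) (u : Config N → ℝ) :
    Real.exp (N * freeEnergy β h u) = partitionFunction β h u := by
  have hN' : (0 : ℝ) < N := by exact_mod_cast hN
  rw [freeEnergy, ← mul_assoc, mul_one_div_cancel hN'.ne', one_mul,
    Real.exp_log (partitionFunction_pos β h u)]

lemma measurable_freeEnergy (β h : ℝ) :
    Measurable (freeEnergy β h : (Config N → ℝ) → ℝ) := by
  unfold freeEnergy partitionFunction hamiltonian
  fun_prop

lemma partitionFunction_treeField (r : OrderParameter n) (hN : 0 < N) {L : ℕ → ℕ}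
    (hL : IsBlockPartition n N L) (β h : ℝ) (g : Vertex n N → ℝ) :
    partitionFunction β h (treeField r L g) = ∑ σ, Real.exp (∑ k : Fin n,
      levelEnergy L (fun k => β * √(N : ℝ) * √(r.q (k + 1) - r.q k)) (β * h) g σ k) := by
  have hN' : 0 < √(N : ℝ) := Real.sqrt_pos.2 (by exact_mod_cast hN)
  refine Finset.sum_congr rfl fun σ _ => ?_
  congr 1
  unfold hamiltonian treeField levelEnergy
  rw [Finset.sum_add_distrib, ← Finset.mul_sum, ← Finset.sum_range (fun k => blockSum L (spin σ) k),
    sum_blockSum_eq hL, mul_add, Finset.mul_sum]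
  congr 1
  · exact Finset.sum_congr rfl fun k _ => by ring
  · field_simp

/-- Exponential moment bound giving the upper bound on the free energy. -/
theorem lintegral_exp_freeEnergy_le (r : OrderParameter n) {β h : ℝ} (hβ : 0 < β) {b : ℕ → ℝ}
    (hb : ∀ k < n, 0 < b k ∧ b k ≤ β) (hmono : ∀ k, k + 1 < n → b k ≤ b (k + 1))
    (hN : 0 < N) {L : ℕ → ℕ} (hL : ∀ k ≤ n, r.x k * N = L k) :
    ∫⁻ g, ENNReal.ofReal (Real.exp (b 0 / β * (N * (freeEnergy β h (treeField r L g) -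
      ∑ k ∈ Finset.range n, (β / b k * ((r.x (k + 1) - r.x k) * Real.log (2 * Real.cosh (b k * h)))
      + β * b k * (r.q (k + 1) - r.q k) / 2))))) ∂(vertexMeasure n N) ≤ 1 := by
  have hP := r.isBlockPartition hL
  have hn := r.pos
  set U := ∑ k ∈ Finset.range n, (β / b k * ((r.x (k + 1) - r.x k) *
    Real.log (2 * Real.cosh (b k * h))) + β * b k * (r.q (k + 1) - r.q k) / 2) with hU
  set c : ℕ → ℝ := fun k => β * √(N : ℝ) * √(r.q (k + 1) - r.q k) with hc
  have hm0 : 0 < b 0 / β := div_pos (hb 0 hn).1 hβ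
  have hmain := lintegral_subtreePartition_rpow_le hP c (β * h) (m := fun k => b k / β)
    (fun k hk => div_pos (hb k hk).1 hβ) (fun k hk => (div_le_one hβ).2 (hb k hk).2)
    (fun k hk => div_le_div_of_nonneg_right (hmono k hk) hβ.le) (Nat.zero_le n)
    (π := (1 : Config N)) (by rw [hP.zero, trunc_zero]) hm0 (fun _ => le_rfl)
  -- With m_k = b_k/β the tilt m_k β h becomes b_k h, and m_k c_k²/2 becomes N β b_k Δq_k / 2.
  have hexp : momentExponent n L c (β * h) (fun k => b k / β) 0 = N * U := by
    rw [momentExponent, ← Finset.range_eq_Ico, hU, Finset.mul_sum]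
    refine Finset.sum_congr rfl fun k hk => ?_
    have hk := Finset.mem_range.1 hk
    have hb' := (hb k hk).1
    rw [r.block_length hL hk, hc]
    simp only
    rw [mul_pow, mul_pow, Real.sq_sqrt (Nat.cast_nonneg N),
      Real.sq_sqrt (sub_nonneg.2 (r.q_lt k hk).le)]
    have : b k / β * (β * h) = b k * h := by field_simp
    rw [this]
    field_simp
  rw [hexp] at hmain
  have hsub : ∀ g : Vertex n N → ℝ, subtreePartition L c (β * h) 0 1 g
      = ENNReal.ofReal (Real.exp (N * freeEnergy β h (treeField r L g))) := by
    intro g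
    rw [exp_mul_freeEnergy hN, partitionFunction_treeField r hN hP,
      ENNReal.ofReal_sum_of_nonneg fun _ _ => (Real.exp_pos _).le, subtreePartition, hP.zero]
    simp [trunc_zero, hc]
  simp_rw [hsub, ofReal_exp_rpow] at hmain
  have hsplit : ∀ g : Vertex n N → ℝ,
      ENNReal.ofReal (Real.exp (b 0 / β * (N * (freeEnergy β h (treeField r L g) - U))))
      = ENNReal.ofReal (Real.exp (-(b 0 / β * (N * U)))) *
        ENNReal.ofReal (Real.exp (b 0 / β * (N * freeEnergy β h (treeField r L g)))) := by
    intro g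
    rw [← ENNReal.ofReal_mul (Real.exp_pos _).le, ← Real.exp_add]
    congr 2; ring
  have hmeas : Measurable fun g : Vertex n N → ℝ =>
      ENNReal.ofReal (Real.exp (b 0 / β * (N * freeEnergy β h (treeField r L g)))) := by
    have := (measurable_freeEnergy β h).comp (measurable_treeField (N := N) r L)
    exact ENNReal.measurable_ofReal.comp (Real.measurable_exp.comp
      ((this.const_mul _).const_mul _))
  simp_rw [hsplit]
  rw [lintegral_const_mul _ hmeas]
  calc _ ≤ ENNReal.ofReal (Real.exp (-(b 0 / β * (N * U)))) *
        ENNReal.ofReal (Real.exp (b 0 / β * (N * U))) := by gcongr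
    _ = 1 := by
      rw [← ENNReal.ofReal_mul (Real.exp_pos _).le, ← Real.exp_add]
      simp

/-- The tilt which equals `b k * h` on the `k`-th block. -/
def blockTilt (n : ℕ) (L : ℕ → ℕ) (b : ℕ → ℝ) (h : ℝ) (i : Fin N) : ℝ :=
  ∑ k ∈ Finset.range n, if L k ≤ i.val ∧ i.val < L (k + 1) then b k * h else 0

lemma blockTilt_eq {L : ℕ → ℕ} (hL : IsBlockPartition n N L) (b : ℕ → ℝ) (h : ℝ) {k : ℕ}
    (hk : k < n) {i : Fin N} (h1 : L k ≤ i.val) (h2 : i.val < L (k + 1)) :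
    blockTilt n L b h i = b k * h := by
  rw [blockTilt, Finset.sum_eq_single_of_mem k (Finset.mem_range.2 hk), if_pos ⟨h1, h2⟩]
  intro j hj hne
  refine if_neg fun hji => hne ?_
  have hj := Finset.mem_range.1 hj
  rcases Nat.lt_trichotomy j k with hlt | heq | hlt
  · have := hL.le_of_le (show j + 1 ≤ k by omega) hk.le
    omega
  · exact heq
  · have := hL.le_of_le (show k + 1 ≤ j by omega) hj.le
    omega

/-- With y = b_k h, the log-weight of a block is y times its deviation from the tilted mean, minus
its length times entropy(tanh y). Typicality bounds the deviation. -/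
lemma prefixWeight_le {r : OrderParameter n} {L : ℕ → ℕ} (hL : ∀ k ≤ n, r.x k * N = L k)
    {b : ℕ → ℝ} {h δ : ℝ} (hh : 0 ≤ h) (hb : ∀ k < n, 0 < b k) {σ : Config N}
    (hσ : σ ∈ typicalConfigs n L (blockTilt n L b h) (δ * N)) {K : ℕ} (hK : K < n) :
    prefixWeight (blockTilt n L b h) (L (K + 1)) σ ≤ Real.exp (N * ∑ k ∈ Finset.range (K + 1),
      (b k * h * δ - (r.x (k + 1) - r.x k) * entropy (Real.tanh (b k * h)))) := by
  have hP := r.isBlockPartition hL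
  rw [prefixWeight_eq_exp, ← sum_blockSum hP (fun i => blockTilt n L b h i * spin σ i -
    Real.log (2 * Real.cosh (blockTilt n L b h i))) hK, Real.exp_le_exp, Finset.mul_sum]
  refine Finset.sum_le_sum fun k hk => ?_
  have hkn : k < n := by have := Finset.mem_range.1 hk; omega
  have hσk : |blockSum L (fun i => spin σ i - Real.tanh (blockTilt n L b h i)) k| ≤ δ * N := by
    classical
    rw [typicalConfigs] at hσ
    exact (Finset.mem_filter.1 hσ).2 k hkn
  have h1 : blockSum L (fun i => blockTilt n L b h i * spin σ i -
      Real.log (2 * Real.cosh (blockTilt n L b h i))) k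
      = b k * h * blockSum L (fun i => spin σ i - Real.tanh (blockTilt n L b h i)) k
        + blockSum L (fun _ : Fin N => - entropy (Real.tanh (b k * h))) k := by
    rw [blockSum, blockSum, blockSum, Finset.mul_sum, ← Finset.sum_add_distrib]
    refine Finset.sum_congr rfl fun i _ => ?_
    split_ifs with hi
    · rw [blockTilt_eq hP b h hkn hi.1 hi.2, ← entropy_tanh]; ring
    · simp
  rw [h1, blockSum_const hP hkn, r.block_length hL hkn]
  have h2 := mul_le_mul_of_nonneg_left ((le_abs_self _).trans hσk)
    (mul_nonneg (hb k hkn).le hh)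
  nlinarith

lemma blockSum_spin_ge {r : OrderParameter n} {L : ℕ → ℕ} (hL : ∀ k ≤ n, r.x k * N = L k)
    {b : ℕ → ℝ} {h δ : ℝ} {σ : Config N}
    (hσ : σ ∈ typicalConfigs n L (blockTilt n L b h) (δ * N)) {k : ℕ} (hk : k < n) :
    N * ((r.x (k + 1) - r.x k) * Real.tanh (b k * h) - δ) ≤ blockSum L (spin σ) k := by
  have hP := r.isBlockPartition hL
  have hσk : |blockSum L (fun i => spin σ i - Real.tanh (blockTilt n L b h i)) k| ≤ δ * N := by
    classical
    rw [typicalConfigs] at hσ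
    exact (Finset.mem_filter.1 hσ).2 k hk
  have h1 : blockSum L (spin σ) k
      = blockSum L (fun i => spin σ i - Real.tanh (blockTilt n L b h i)) k
        + blockSum L (fun _ : Fin N => Real.tanh (b k * h)) k := by
    rw [blockSum, blockSum, blockSum, ← Finset.sum_add_distrib]
    refine Finset.sum_congr rfl fun i _ => ?_
    split_ifs with hi
    · rw [blockTilt_eq hP b h hk hi.1 hi.2]; ring
    · simp
  rw [h1, blockSum_const hP hk, r.block_length hL hk]
  have := (abs_le.1 hσk).1
  nlinarith

/-- Quantitative lower bound on the free energy for a fixed system size. -/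
theorem measure_freeEnergy_lt_le (r : OrderParameter n) {β h : ℝ} (hβ : 0 < β) (hh : 0 ≤ h)
    {b : ℕ → ℝ} (hb : ∀ k < n, 0 < b k) (hN : 0 < N) {L : ℕ → ℕ}
    (hL : ∀ k ≤ n, r.x k * N = L k) {η δ : ℝ}
    (htyp : 1 / 2 ≤ ∑ σ ∈ typicalConfigs (N := N) n L (blockTilt n L b h) (δ * N),
      configWeight (blockTilt n L b h) σ)
    (htail : ∀ k < n, Real.exp (-(N * ((1 - η) ^ 2 * b k ^ 2 * (r.q (k + 1) - r.q k) / 2 + δ)))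
      ≤ gaussTail ((1 - η) * b k * √(r.q (k + 1) - r.q k) * √(N : ℝ))) :
    vertexMeasure n N {g | freeEnergy β h (treeField r L g) <
        ∑ k ∈ Finset.range n, ((r.x (k + 1) - r.x k) * entropy (Real.tanh (b k * h))
          - (1 - η) ^ 2 * b k ^ 2 * (r.q (k + 1) - r.q k) / 2
          + (1 - η) * (β * b k * (r.q (k + 1) - r.q k))
          + β * h * ((r.x (k + 1) - r.x k) * Real.tanh (b k * h))
          - δ * (β * h + b k * h + 1)) - Real.log 4 / N}
      ≤ ENNReal.ofReal (8 * ∑ K ∈ Finset.range n, Real.exp (N * ∑ k ∈ Finset.range (K + 1),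
        ((1 - η) ^ 2 * b k ^ 2 * (r.q (k + 1) - r.q k) / 2
          - (r.x (k + 1) - r.x k) * entropy (Real.tanh (b k * h))
          + δ * (b k * h + 1)))) := by
  have hP := r.isBlockPartition hL
  have hn := r.pos
  have hN' : (0 : ℝ) < N := by exact_mod_cast hN
  set v : ℕ → ℝ := fun k => (1 - η) * b k * √(r.q (k + 1) - r.q k) * √(N : ℝ) with hv
  set y : Fin N → ℝ := blockTilt n L b h with hy
  set M := typicalConfigs n L y (δ * N) with hM
  set A : ℕ → ℝ := fun K => Real.exp (N * ∑ k ∈ Finset.range (K + 1),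
      (b k * h * δ - (r.x (k + 1) - r.x k) * entropy (Real.tanh (b k * h)))) with hA
  have hpos : ∀ k < n, 0 < gaussTail (v k) := fun k hk =>
    (Real.exp_pos _).trans_le (htail k hk)
  have hmass := measure_branchMass_lt_le hP hpos y M (A := A)
    (fun σ hσ K hK => prefixWeight_le hL hh hb hσ hK) htyp
  refine (measure_mono ?_).trans (hmass.trans (ENNReal.ofReal_le_ofReal ?_))
  · intro g hg
    simp only [Set.mem_ofPred_eq] at hg ⊢
    by_contra hcon
    push Not at hcon
    refine absurd hg (not_lt.2 ?_)
    -- the energy of every contributing branch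
    set E : ℝ := N * ∑ k ∈ Finset.range n, ((1 - η) * (β * b k * (r.q (k + 1) - r.q k))
      + β * h * ((r.x (k + 1) - r.x k) * Real.tanh (b k * h) - δ)) with hE
    have henergy : ∀ σ ∈ M, g ∈ branchEvent n L v σ → E ≤ ∑ k : Fin n,
        levelEnergy L (fun k => β * √(N : ℝ) * √(r.q (k + 1) - r.q k)) (β * h) g σ k := by
      intro σ hσ hgσ
      rw [hE, Finset.mul_sum, Finset.sum_range]
      refine Finset.sum_le_sum fun k _ => ?_
      have h1 := mul_le_mul_of_nonneg_left (hgσ k)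
        (show 0 ≤ β * √(N : ℝ) * √(r.q (k + 1) - r.q k) by positivity)
      have h2 := mul_le_mul_of_nonneg_left (blockSum_spin_ge hL hσ k.2)
        (show 0 ≤ β * h by positivity)
      have h3 : β * √(N : ℝ) * √(r.q (k + 1) - r.q k) * v k
          = N * ((1 - η) * (β * b k * (r.q (k + 1) - r.q k))) := by
        have e1 := Real.mul_self_sqrt hN'.le
        have e2 := Real.mul_self_sqrt (sub_nonneg.2 (r.q_lt k k.2).le)
        rw [hv]
        linear_combination (β * (1 - η) * b k * (√(r.q (k + 1) - r.q k) * √(r.q (k + 1) - r.q k)))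
          * e1 + (β * (1 - η) * b k * N) * e2
      rw [h3] at h1
      rw [levelEnergy]
      linarith
    -- On typical branches the weight is at most A(n - 1), so the weighted mass converts into a
    -- lower bound on the unweighted partition function.
    have hZ : Real.exp E * branchMass L v y M g
        ≤ A (n - 1) * partitionFunction β h (treeField r L g) := by
      rw [partitionFunction_treeField r hN hP, branchMass, Finset.mul_sum, Finset.mul_sum]
      refine (Finset.sum_le_sum (g := fun σ => A (n - 1) * Real.exp (∑ k : Fin n,
        levelEnergy L (fun k => β * √(N : ℝ) * √(r.q (k + 1) - r.q k)) (β * h) g σ k))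
        fun σ hσ => ?_).trans (Finset.sum_le_sum_of_subset_of_nonneg (Finset.subset_univ M)
          fun σ _ _ => mul_nonneg (Real.exp_pos _).le (Real.exp_pos _).le)
      by_cases hgσ : g ∈ branchEvent n L v σ
      · have h1 := prefixWeight_le hL hh hb hσ (show n - 1 < n by omega)
        rw [Nat.sub_add_cancel hn, hP.last, prefixWeight_of_le le_rfl] at h1
        have h2 : configWeight y σ ≤ A (n - 1) := by
          rw [hA]; simp only; rwa [Nat.sub_add_cancel hn]
        rw [Set.indicator_of_mem hgσ, Pi.one_apply, mul_one, mul_comm]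
        exact mul_le_mul h2 (Real.exp_le_exp.2 (henergy σ hσ hgσ)) (Real.exp_pos _).le
          (Real.exp_pos _).le
      · rw [Set.indicator_of_notMem hgσ, mul_zero, mul_zero]
        positivity
    have hprod : Real.exp (∑ k ∈ Finset.range n,
        -(N * ((1 - η) ^ 2 * b k ^ 2 * (r.q (k + 1) - r.q k) / 2 + δ)))
        ≤ ∏ k ∈ Finset.range n, gaussTail (v k) := by
      rw [Real.exp_sum]
      exact Finset.prod_le_prod (fun _ _ => (Real.exp_pos _).le)
        fun k hk => htail k (Finset.mem_range.1 hk)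
    have h4 : (1 / 4 : ℝ) = Real.exp (- Real.log 4) := by
      rw [Real.exp_neg, Real.exp_log (by norm_num)]; norm_num
    have hfin : Real.exp (E + (- Real.log 4 + ∑ k ∈ Finset.range n,
        -(N * ((1 - η) ^ 2 * b k ^ 2 * (r.q (k + 1) - r.q k) / 2 + δ))))
        ≤ Real.exp (N * ∑ k ∈ Finset.range n,
          (b k * h * δ - (r.x (k + 1) - r.x k) * entropy (Real.tanh (b k * h)))
          + N * freeEnergy β h (treeField r L g)) := by
      rw [Real.exp_add, Real.exp_add (- Real.log 4), ← h4, Real.exp_add, exp_mul_freeEnergy hN]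
      have h5 : A (n - 1) = Real.exp (N * ∑ k ∈ Finset.range n,
          (b k * h * δ - (r.x (k + 1) - r.x k) * entropy (Real.tanh (b k * h)))) := by
        rw [hA]; simp only; rw [Nat.sub_add_cancel hn]
      rw [← h5]
      refine le_trans ?_ hZ
      refine mul_le_mul_of_nonneg_left (le_trans ?_ hcon) (Real.exp_pos _).le
      exact mul_le_mul_of_nonneg_left hprod (by norm_num)
    rw [Real.exp_le_exp, hE] at hfin
    rw [sub_le_iff_le_add, ← mul_le_mul_iff_right₀ hN', mul_add, mul_div_cancel₀ _ hN'.ne']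
    simp only [Finset.sum_neg_distrib, ← Finset.mul_sum] at hfin
    have hsplit : ∑ k ∈ Finset.range n, ((r.x (k + 1) - r.x k) * entropy (Real.tanh (b k * h))
          - (1 - η) ^ 2 * b k ^ 2 * (r.q (k + 1) - r.q k) / 2
          + (1 - η) * (β * b k * (r.q (k + 1) - r.q k))
          + β * h * ((r.x (k + 1) - r.x k) * Real.tanh (b k * h))
          - δ * (β * h + b k * h + 1))
        = ∑ k ∈ Finset.range n, ((1 - η) * (β * b k * (r.q (k + 1) - r.q k))
          + β * h * ((r.x (k + 1) - r.x k) * Real.tanh (b k * h) - δ))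
          - ∑ k ∈ Finset.range n, ((1 - η) ^ 2 * b k ^ 2 * (r.q (k + 1) - r.q k) / 2 + δ)
          - ∑ k ∈ Finset.range n,
          (b k * h * δ - (r.x (k + 1) - r.x k) * entropy (Real.tanh (b k * h))) := by
      rw [← Finset.sum_sub_distrib, ← Finset.sum_sub_distrib]
      exact Finset.sum_congr rfl fun k _ => by ring
    rw [hsplit, mul_sub, mul_sub]
    linarith
  -- Up to the δ corrections, the summand at K is the inverse of the expected number of good initial
  -- segments through level K.
  · refine mul_le_mul_of_nonneg_left (Finset.sum_le_sum fun K hK => ?_) (by norm_num)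
    have hKn := Finset.mem_range.1 hK
    have hinv : ∏ k ∈ Finset.range (K + 1), (gaussTail (v k))⁻¹
        ≤ ∏ k ∈ Finset.range (K + 1),
          Real.exp (N * ((1 - η) ^ 2 * b k ^ 2 * (r.q (k + 1) - r.q k) / 2 + δ)) := by
      refine Finset.prod_le_prod (fun k hk => ?_) fun k hk => ?_
      · exact (inv_pos.2 (hpos k (by have := Finset.mem_range.1 hk; omega))).le
      · have hkn : k < n := by have := Finset.mem_range.1 hk; omega
        have := inv_anti₀ (Real.exp_pos _) (htail k hkn)
        rwa [← Real.exp_neg, neg_neg] at this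
    refine (mul_le_mul_of_nonneg_left hinv (Real.exp_pos _).le).trans_eq ?_
    rw [← Real.exp_sum, ← Real.exp_add, ← Finset.mul_sum, ← mul_add, ← Finset.sum_add_distrib]
    congr 2
    exact Finset.sum_congr rfl fun k _ => by ring

/-- For s ≥ 1, (us + 1)²/2 + 1 ≤ u²s²/2 + (u + 3/2)s, and the linear term is absorbed into δs². -/
lemma exp_le_gaussTail {u δ s : ℝ} (hu : 0 ≤ u) (hδ : 0 < δ) (hs1 : 1 ≤ s)
    (hs : (u + 3 / 2) / δ ≤ s) : Real.exp (-(s ^ 2 * (u ^ 2 / 2 + δ))) ≤ gaussTail (u * s) := by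
  refine le_trans (Real.exp_le_exp.2 ?_) (le_gaussTail (by positivity))
  rw [div_le_iff₀ hδ] at hs
  nlinarith

/-- The probability that the free energy is smaller than its limit is exponentially small. -/
theorem exists_measure_freeEnergy_lt_le (r : OrderParameter n) {β h : ℝ} (hβ : 0 < β) (hh : 0 ≤ h)
    {b : ℕ → ℝ} (hb : ∀ k < n, 0 < b k)
    (hfeas : ∀ K ≤ n, 0 ≤ ∑ k ∈ Finset.range K, ((r.x (k + 1) - r.x k) *
      entropy (Real.tanh (b k * h)) - (b k) ^ 2 * (r.q (k + 1) - r.q k) / 2))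
    {ε : ℝ} (hε : 0 < ε) :
    ∃ C κ : ℝ, 0 < κ ∧ ∃ N₀ : ℕ, ∀ N ≥ N₀, ∀ L : ℕ → ℕ, (∀ k ≤ n, r.x k * N = L k) →
      vertexMeasure n N {g | freeEnergy β h (treeField r L g) <
        ∑ k ∈ Finset.range n, ((r.x (k + 1) - r.x k) * entropy (Real.tanh (b k * h))
          - (b k) ^ 2 * (r.q (k + 1) - r.q k) / 2 + β * b k * (r.q (k + 1) - r.q k)
          + β * h * ((r.x (k + 1) - r.x k) * Real.tanh (b k * h))) - ε}
        ≤ ENNReal.ofReal (C * Real.exp (-(κ * N))) := by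
  have hn := r.pos
  have hx : ∀ k < n, 0 < r.x (k + 1) - r.x k := fun k hk => sub_pos.2 (r.x_lt k hk)
  have hq : ∀ k < n, 0 < r.q (k + 1) - r.q k := fun k hk => sub_pos.2 (r.q_lt k hk)
  set s : ℕ → ℝ := fun k => (r.x (k + 1) - r.x k) * entropy (Real.tanh (b k * h)) with hs
  have hs0 : ∀ k < n, 0 < s k := fun k hk => mul_pos (hx k hk) (entropy_tanh_pos _)
  set B := ∑ k ∈ Finset.range n, β * b k * (r.q (k + 1) - r.q k) with hBdef
  have hB : 0 < B := Finset.sum_pos (fun k hk => by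
    have hk := Finset.mem_range.1 hk
    have := hb k hk
    have := hq k hk
    positivity) ⟨0, Finset.mem_range.2 hn⟩
  set D := ∑ k ∈ Finset.range n, (β * h + b k * h + 1) with hDdef
  have hDterm : ∀ k ∈ Finset.range n, 0 < β * h + b k * h + 1 := fun k hk => by
    have := hb k (Finset.mem_range.1 hk)
    positivity
  have hD : 0 < D := Finset.sum_pos hDterm ⟨0, Finset.mem_range.2 hn⟩
  -- Lowering the thresholds by the factor 1 - η gives strict slack even where the entropy
  -- constraint is tight, and loses at most ηB ≤ ε/3 of free energy.
  obtain ⟨η, hη0, hη1, hηB⟩ : ∃ η : ℝ, 0 < η ∧ η ≤ 1 ∧ η * B ≤ ε / 3 :=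
    ⟨min 1 (ε / 3 / B), lt_min one_pos (by positivity), min_le_left _ _,
      (mul_le_mul_of_nonneg_right (min_le_right _ _) hB.le).trans_eq
        (div_mul_cancel₀ _ hB.ne')⟩
  -- δ covers the magnetization fluctuations and the tail corrections; these may cost a further ε/3
  -- and at most half of the slack η s_0.
  obtain ⟨δ, hδ0, hδ1, hδ2⟩ : ∃ δ : ℝ, 0 < δ ∧ δ * D ≤ ε / 3 ∧ δ * D ≤ η * s 0 / 2 := by
    have := hs0 0 hn
    refine ⟨min (ε / 3 / D) (η * s 0 / 2 / D), lt_min (by positivity) (by positivity), ?_, ?_⟩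
    · exact (mul_le_mul_of_nonneg_right (min_le_left _ _) hD.le).trans_eq
        (div_mul_cancel₀ _ hD.ne')
    · exact (mul_le_mul_of_nonneg_right (min_le_right _ _) hD.le).trans_eq
        (div_mul_cancel₀ _ hD.ne')
  have htend : Tendsto (fun N : ℕ => √(N : ℝ)) atTop atTop :=
    Real.tendsto_sqrt_atTop.comp tendsto_natCast_atTop_atTop
  have hev : ∀ᶠ N : ℕ in atTop, 0 < N ∧ 1 ≤ √(N : ℝ) ∧ (2 * n / δ ^ 2 ≤ (N : ℝ)) ∧
      (Real.log 4 / (ε / 3) ≤ N) ∧ ∀ k ∈ Finset.range n,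
        ((1 - η) * b k * √(r.q (k + 1) - r.q k) + 3 / 2) / δ ≤ √(N : ℝ) := by
    refine (eventually_gt_atTop 0).and ((htend.eventually_ge_atTop _).and
      ((tendsto_natCast_atTop_atTop.eventually_ge_atTop _).and
        ((tendsto_natCast_atTop_atTop.eventually_ge_atTop _).and ?_)))
    rw [Filter.eventually_all_finset]
    exact fun k _ => htend.eventually_ge_atTop _
  obtain ⟨N₀, hN₀⟩ := eventually_atTop.1 hev
  refine ⟨8 * n, η * s 0 / 2, by have := hs0 0 hn; positivity, N₀, fun N hNN L hL => ?_⟩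
  obtain ⟨hN, hsq1, hNn, hNlog, hNk⟩ := hN₀ N hNN
  have hN' : (0 : ℝ) < N := by exact_mod_cast hN
  have hlow := measure_freeEnergy_lt_le (N := N) r hβ hh hb hN hL (η := η) (δ := δ) ?_ ?_
  · refine (measure_mono fun g hg => ?_).trans (hlow.trans (ENNReal.ofReal_le_ofReal ?_))
    · simp only [Set.mem_ofPred_eq] at hg ⊢
      refine hg.trans_le ?_
      have hlog : Real.log 4 / N ≤ ε / 3 := by
        rw [div_le_iff₀ (by positivity)] at hNlog
        rw [div_le_iff₀ hN']; linarith
      have hsum : ∑ k ∈ Finset.range n, ((r.x (k + 1) - r.x k) * entropy (Real.tanh (b k * h))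
          - (b k) ^ 2 * (r.q (k + 1) - r.q k) / 2 + β * b k * (r.q (k + 1) - r.q k)
          + β * h * ((r.x (k + 1) - r.x k) * Real.tanh (b k * h))) - η * B - δ * D
          ≤ ∑ k ∈ Finset.range n, ((r.x (k + 1) - r.x k) * entropy (Real.tanh (b k * h))
          - (1 - η) ^ 2 * b k ^ 2 * (r.q (k + 1) - r.q k) / 2
          + (1 - η) * (β * b k * (r.q (k + 1) - r.q k))
          + β * h * ((r.x (k + 1) - r.x k) * Real.tanh (b k * h))
          - δ * (β * h + b k * h + 1)) := by
        rw [hBdef, hDdef, Finset.mul_sum, Finset.mul_sum, ← Finset.sum_sub_distrib,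
          ← Finset.sum_sub_distrib]
        refine Finset.sum_le_sum fun k hk => ?_
        have h1 := hq k (Finset.mem_range.1 hk)
        have h2 : (1 - η) ^ 2 ≤ 1 := by nlinarith
        have h3 := mul_le_mul_of_nonneg_right h2
          (show 0 ≤ b k ^ 2 * (r.q (k + 1) - r.q k) by positivity)
        nlinarith
      linarith
    · have hK : ∀ K ∈ Finset.range n, Real.exp (N * ∑ k ∈ Finset.range (K + 1),
        ((1 - η) ^ 2 * b k ^ 2 * (r.q (k + 1) - r.q k) / 2
          - (r.x (k + 1) - r.x k) * entropy (Real.tanh (b k * h))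
          + δ * (b k * h + 1))) ≤ Real.exp (-(η * s 0 / 2 * N)) := by
        intro K hK
        have hKn := Finset.mem_range.1 hK
        rw [Real.exp_le_exp]
        have h1 := hfeas (K + 1) hKn
        have h2 : s 0 ≤ ∑ k ∈ Finset.range (K + 1), s k :=
          Finset.single_le_sum (f := s) (fun k hk => (hs0 k (by
            have := Finset.mem_range.1 hk; omega)).le) (Finset.mem_range.2 (Nat.succ_pos K))
        have h3 : ∑ k ∈ Finset.range (K + 1), δ * (b k * h + 1) ≤ δ * D := by
          rw [hDdef, Finset.mul_sum]
          refine (Finset.sum_le_sum fun k hk => ?_).trans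
            (Finset.sum_le_sum_of_subset_of_nonneg
              (Finset.range_subset_range.2 (show K + 1 ≤ n from hKn))
              fun k hk _ => mul_nonneg hδ0.le (hDterm k hk).le)
          have : 0 ≤ β * h := by positivity
          nlinarith
        have h4 : ∑ k ∈ Finset.range (K + 1),
            ((1 - η) ^ 2 * b k ^ 2 * (r.q (k + 1) - r.q k) / 2
              - (r.x (k + 1) - r.x k) * entropy (Real.tanh (b k * h)) + δ * (b k * h + 1))
            = - (1 - η) ^ 2 * ∑ k ∈ Finset.range (K + 1), ((r.x (k + 1) - r.x k) *
              entropy (Real.tanh (b k * h)) - (b k) ^ 2 * (r.q (k + 1) - r.q k) / 2)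
              - (1 - (1 - η) ^ 2) * ∑ k ∈ Finset.range (K + 1), s k
              + ∑ k ∈ Finset.range (K + 1), δ * (b k * h + 1) := by
          rw [Finset.mul_sum, Finset.mul_sum, ← Finset.sum_sub_distrib, ← Finset.sum_add_distrib]
          exact Finset.sum_congr rfl fun k _ => by rw [hs]; ring
        rw [h4]
        -- The right side is η(2 - η), and η ≤ 1. Every prefix contains level 0, so the slack is at
        -- least η s_0 for all K.
        have h5 : η ≤ 1 - (1 - η) ^ 2 := by nlinarith
        have h6 : η * s 0 ≤ (1 - (1 - η) ^ 2) * ∑ k ∈ Finset.range (K + 1), s k :=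
          mul_le_mul h5 h2 (hs0 0 hn).le (by nlinarith)
        have h7 := mul_nonneg (sq_nonneg (1 - η)) h1
        nlinarith
      calc _ ≤ 8 * ∑ K ∈ Finset.range n, Real.exp (-(η * s 0 / 2 * N)) :=
            mul_le_mul_of_nonneg_left (Finset.sum_le_sum hK) (by norm_num)
        _ = _ := by simp; ring
  · refine le_trans ?_ (sum_typicalConfigs_ge n L _ (by positivity))
    rw [div_le_iff₀ (by positivity)] at hNn
    have : (n : ℝ) * (N / (δ * N) ^ 2) = n / (δ ^ 2 * N) := by field_simp
    rw [this]
    have : (n : ℝ) / (δ ^ 2 * N) ≤ 1 / 2 := by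
      rw [div_le_iff₀ (by positivity)]; linarith
    linarith
  · intro k hk
    have h1 := exp_le_gaussTail (u := (1 - η) * b k * √(r.q (k + 1) - r.q k)) (s := √(N : ℝ))
      (mul_nonneg (mul_nonneg (by linarith) (hb k hk).le) (Real.sqrt_nonneg _)) hδ0 hsq1
      (hNk k (Finset.mem_range.2 hk))
    rwa [mul_pow, mul_pow, Real.sq_sqrt (hq k hk).le, Real.sq_sqrt hN'.le] at h1

end GREM

namespace GREM

/-! ### From exponential bounds to almost sure and `L¹` convergence -/

section Convergence

variable {Ω : Type*} [MeasurableSpace Ω] {P : Measure Ω}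

/-- Borel–Cantelli with a geometric series; no relation between the sets for different indices is
needed. -/
lemma ae_eventually_notMem_of_exp_bound {s : ℕ → Set Ω} {C κ : ℝ} (hκ : 0 < κ) {a₀ : ℕ}
    (h : ∀ a ≥ a₀, P (s a) ≤ ENNReal.ofReal (C * Real.exp (-(κ * a)))) :
    ∀ᵐ ω ∂P, ∀ᶠ a in atTop, ω ∉ s a := by
  have hsum : Summable fun a : ℕ => C * Real.exp (-(κ * ((a + a₀ : ℕ) : ℝ))) := by
    have h1 : Summable fun a : ℕ => Real.exp (-κ) ^ a :=
      summable_geometric_of_lt_one (Real.exp_pos _).le (by rw [← Real.exp_zero]; exact Real.exp_lt_exp.2 (by linarith))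
    refine ((h1.mul_left (C * Real.exp (-(κ * a₀))))).congr fun a => ?_
    rw [← Real.exp_nat_mul, mul_assoc, ← Real.exp_add]
    congr 2
    push_cast; ring
  have hne : ∑' a, P (s (a + a₀)) ≠ ⊤ :=
    ne_top_of_le_ne_top hsum.tsum_ofReal_ne_top
      (ENNReal.tsum_le_tsum fun a => h (a + a₀) (Nat.le_add_left _ _))
  filter_upwards [ae_eventually_notMem hne] with ω hω
  obtain ⟨b, hb⟩ := eventually_atTop.1 hω
  refine eventually_atTop.2 ⟨b + a₀, fun a ha => ?_⟩
  have := hb (a - a₀) (by omega)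
  rwa [Nat.sub_add_cancel (by omega)] at this

variable {N : ℕ → ℕ} {X : ℕ → Ω → ℝ} {ℓ m : ℝ}

/-- Markov's inequality gives probability at most exp(-mεN_a), and N_a ≥ a by strict monotonicity
makes this summable in a. -/
lemma ae_eventually_le_of_exp_moment (hN : StrictMono N) (hX : ∀ a, AEMeasurable (X a) P)
    (hm : 0 < m)
    (hup : ∀ a, ∫⁻ ω, ENNReal.ofReal (Real.exp (m * (N a * (X a ω - ℓ)))) ∂P ≤ 1)
    {ε : ℝ} (hε : 0 < ε) : ∀ᵐ ω ∂P, ∀ᶠ a in atTop, X a ω ≤ ℓ + ε := by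
  have h := ae_eventually_notMem_of_exp_bound (P := P) (s := fun a => {ω | ℓ + ε < X a ω})
    (C := 1) (κ := m * ε) (by positivity) (a₀ := 0) fun a _ => ?_
  · simpa using h
  have hmk := meas_ge_le_lintegral_div (μ := P)
    (f := fun ω => ENNReal.ofReal (Real.exp (m * (N a * (X a ω - ℓ)))))
    (by have := hX a; fun_prop)
    (ε := ENNReal.ofReal (Real.exp (m * (N a * ε)))) (by simp [Real.exp_pos]) (by simp)
  refine (measure_mono fun ω hω => ?_).trans (hmk.trans ?_)
  · simp only [Set.mem_ofPred_eq] at hω ⊢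
    refine ENNReal.ofReal_le_ofReal (Real.exp_le_exp.2 ?_)
    gcongr
    linarith
  · refine (ENNReal.div_le_div_right (hup a) _).trans ?_
    rw [one_div, ← ENNReal.ofReal_inv_of_pos (Real.exp_pos _), ← Real.exp_neg, one_mul]
    refine ENNReal.ofReal_le_ofReal (Real.exp_le_exp.2 ?_)
    have : (a : ℝ) ≤ N a := by exact_mod_cast hN.le_apply
    have := mul_le_mul_of_nonneg_left this (show 0 ≤ m * ε by positivity)
    nlinarith

lemma ae_eventually_ge_of_exp_bound (hN : StrictMono N)
    (hlow : ∀ ε > 0, ∃ C κ : ℝ, 0 < κ ∧ ∃ N₀ : ℕ, ∀ a, N₀ ≤ N a →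
      P {ω | X a ω < ℓ - ε} ≤ ENNReal.ofReal (C * Real.exp (-(κ * N a))))
    {ε : ℝ} (hε : 0 < ε) : ∀ᵐ ω ∂P, ∀ᶠ a in atTop, ℓ - ε ≤ X a ω := by
  obtain ⟨C, κ, hκ, N₀, h⟩ := hlow ε hε
  have h := ae_eventually_notMem_of_exp_bound (P := P) (s := fun a => {ω | X a ω < ℓ - ε})
    -- Replacing N_a by the smaller a in the exponent requires a nonnegative constant.
    (C := |C|) hκ (a₀ := N₀) fun a ha => ?_
  · simpa using h
  refine (h a (ha.le.trans hN.le_apply)).trans (ENNReal.ofReal_le_ofReal ?_)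
  have : (a : ℝ) ≤ N a := by exact_mod_cast hN.le_apply
  refine (mul_le_mul_of_nonneg_right (le_abs_self C) (Real.exp_pos _).le).trans ?_
  gcongr

/-- Almost sure convergence from exponential upper and lower deviation bounds. -/
theorem ae_tendsto_of_exp_bounds (hN : StrictMono N) (hX : ∀ a, AEMeasurable (X a) P)
    (hm : 0 < m)
    (hup : ∀ a, ∫⁻ ω, ENNReal.ofReal (Real.exp (m * (N a * (X a ω - ℓ)))) ∂P ≤ 1)
    (hlow : ∀ ε > 0, ∃ C κ : ℝ, 0 < κ ∧ ∃ N₀ : ℕ, ∀ a, N₀ ≤ N a →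
      P {ω | X a ω < ℓ - ε} ≤ ENNReal.ofReal (C * Real.exp (-(κ * N a)))) :
    ∀ᵐ ω ∂P, Tendsto (fun a => X a ω) atTop (𝓝 ℓ) := by
  have h1 : ∀ᵐ ω ∂P, ∀ j : ℕ, ∀ᶠ a in atTop, X a ω ≤ ℓ + 1 / ((j : ℝ) + 1) :=
    ae_all_iff.2 fun j => ae_eventually_le_of_exp_moment hN hX hm hup (by positivity)
  have h2 : ∀ᵐ ω ∂P, ∀ j : ℕ, ∀ᶠ a in atTop, ℓ - 1 / ((j : ℝ) + 1) ≤ X a ω :=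
    ae_all_iff.2 fun j => ae_eventually_ge_of_exp_bound hN hlow (by positivity)
  filter_upwards [h1, h2] with ω hω1 hω2
  rw [Metric.tendsto_atTop']
  intro ε hε
  obtain ⟨j, hj⟩ := exists_nat_one_div_lt hε
  obtain ⟨a, ha⟩ := eventually_atTop.1 ((hω1 j).and (hω2 j))
  refine ⟨a, fun b hb => ?_⟩
  obtain ⟨h3, h4⟩ := ha b hb.le
  rw [Real.dist_eq, abs_lt]
  constructor <;> linarith

/-- Upper deviations are controlled by the exponential. Lower ones are at most ε, or else at most
|ℓ| + V because x ≥ -V. -/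
lemma enorm_sub_le {x ℓ V ε K : ℝ} (hK : 0 < K) (hV : 0 ≤ V) (hxV : -V ≤ x) (hε : 0 ≤ ε) :
    ‖x - ℓ‖ₑ ≤ ENNReal.ofReal (1 / K) * ENNReal.ofReal (Real.exp (K * (x - ℓ))) +
      ENNReal.ofReal ε + (if x < ℓ - ε then ENNReal.ofReal |ℓ| else 0) + ENNReal.ofReal V := by
  rw [Real.enorm_eq_ofReal_abs, ← ENNReal.ofReal_mul (by positivity)]
  have hif : (if x < ℓ - ε then ENNReal.ofReal |ℓ| else 0)
      = ENNReal.ofReal (if x < ℓ - ε then |ℓ| else 0) := by split_ifs <;> simp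
  have hif0 : 0 ≤ if x < ℓ - ε then |ℓ| else 0 := by
    split_ifs
    · exact abs_nonneg ℓ
    · rfl
  have he : 0 ≤ 1 / K * Real.exp (K * (x - ℓ)) := by positivity
  rw [hif, ← ENNReal.ofReal_add he hε, ← ENNReal.ofReal_add (by positivity) hif0,
    ← ENNReal.ofReal_add (by positivity) hV]
  refine ENNReal.ofReal_le_ofReal (abs_le'.2 ⟨?_, ?_⟩)
  · have h1 := Real.add_one_le_exp (K * (x - ℓ))
    have h2 : x - ℓ ≤ 1 / K * Real.exp (K * (x - ℓ)) := by
      rw [one_div, ← div_eq_inv_mul, le_div_iff₀ hK]; linarith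
    linarith
  · split_ifs with h
    · linarith [le_abs_self ℓ]
    · linarith

/-- Used with K = mN, so the exponential term contributes only 1/(mN). -/
lemma lintegral_enorm_sub_le [IsProbabilityMeasure P] {X : Ω → ℝ} {V : Ω → ℝ} {K ε : ℝ}
    (hX : AEMeasurable X P) (hVm : AEMeasurable V P) (hK : 0 < K) (hV : ∀ ω, 0 ≤ V ω)
    (hXV : ∀ ω, -V ω ≤ X ω) (hε : 0 ≤ ε)
    (hup : ∫⁻ ω, ENNReal.ofReal (Real.exp (K * (X ω - ℓ))) ∂P ≤ 1) :
    ∫⁻ ω, ‖X ω - ℓ‖ₑ ∂P ≤ ENNReal.ofReal (1 / K) + ENNReal.ofReal ε +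
      ENNReal.ofReal |ℓ| * P {ω | X ω < ℓ - ε} + ∫⁻ ω, ENNReal.ofReal (V ω) ∂P := by
  have hset : NullMeasurableSet {ω | X ω < ℓ - ε} P :=
    nullMeasurableSet_lt hX aemeasurable_const
  refine (lintegral_mono fun ω => enorm_sub_le hK (hV ω) (hXV ω) hε).trans ?_
  have hm1 : AEMeasurable (fun ω => ENNReal.ofReal (1 / K) *
      ENNReal.ofReal (Real.exp (K * (X ω - ℓ)))) P := by fun_prop
  have hind : (fun ω => if X ω < ℓ - ε then ENNReal.ofReal |ℓ| else 0)
      = {ω | X ω < ℓ - ε}.indicator fun _ => ENNReal.ofReal |ℓ| := by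
    ext ω
    simp [Set.indicator_apply]
  rw [lintegral_add_right' _ (by fun_prop), lintegral_add_left' (by fun_prop),
    lintegral_add_left' hm1, lintegral_const_mul'' _ (by fun_prop), lintegral_const, measure_univ,
    mul_one, hind, lintegral_indicator_const₀ hset]
  gcongr
  exact mul_le_of_le_one_right zero_le hup

/-- `L¹` convergence from exponential upper and lower deviation bounds. -/
theorem tendsto_lintegral_enorm_sub_of_exp_bounds [IsProbabilityMeasure P] (hN : StrictMono N)
    (hNpos : ∀ a, 0 < N a) {V : ℕ → Ω → ℝ}
    (hX : ∀ a, AEMeasurable (X a) P) (hVm : ∀ a, AEMeasurable (V a) P) (hm : 0 < m)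
    (hV : ∀ a ω, 0 ≤ V a ω) (hXV : ∀ a ω, -V a ω ≤ X a ω)
    (hV0 : Tendsto (fun a => ∫⁻ ω, ENNReal.ofReal (V a ω) ∂P) atTop (𝓝 0))
    (hup : ∀ a, ∫⁻ ω, ENNReal.ofReal (Real.exp (m * (N a * (X a ω - ℓ)))) ∂P ≤ 1)
    (hlow : ∀ ε > 0, ∃ C κ : ℝ, 0 < κ ∧ ∃ N₀ : ℕ, ∀ a, N₀ ≤ N a →
      P {ω | X a ω < ℓ - ε} ≤ ENNReal.ofReal (C * Real.exp (-(κ * N a)))) :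
    Tendsto (fun a => ∫⁻ ω, ‖X a ω - ℓ‖ₑ ∂P) atTop (𝓝 0) := by
  have hNtop : Tendsto (fun a => (N a : ℝ)) atTop atTop :=
    tendsto_natCast_atTop_atTop.comp hN.tendsto_atTop
  have hbound : ∀ ε : ℝ, 0 < ε → ∀ᶠ a in atTop,
      ∫⁻ ω, ‖X a ω - ℓ‖ₑ ∂P ≤ ENNReal.ofReal (4 * ε) := by
    intro ε hε
    obtain ⟨C, κ, hκ, N₀, h⟩ := hlow ε hε
    have t1 : Tendsto (fun a => ENNReal.ofReal (1 / (m * N a))) atTop (𝓝 0) := by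
      have := (tendsto_inv_atTop_zero.comp (hNtop.const_mul_atTop hm))
      rw [← ENNReal.ofReal_zero]
      refine ENNReal.tendsto_ofReal (this.congr fun a => ?_)
      simp
    have t2 : Tendsto (fun a => ENNReal.ofReal |ℓ| *
        ENNReal.ofReal (C * Real.exp (-(κ * N a)))) atTop (𝓝 0) := by
      have h1 : Tendsto (fun a => Real.exp (-(κ * N a))) atTop (𝓝 0) :=
        Real.tendsto_exp_neg_atTop_nhds_zero.comp (hNtop.const_mul_atTop hκ)
      have h2 := (ENNReal.tendsto_ofReal ((h1.const_mul (|ℓ| * C))))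
      rw [mul_zero, ENNReal.ofReal_zero] at h2
      refine h2.congr fun a => ?_
      rw [← ENNReal.ofReal_mul (abs_nonneg ℓ), mul_assoc]
    have hε' : (0 : ENNReal) < ENNReal.ofReal ε := ENNReal.ofReal_pos.2 hε
    filter_upwards [ENNReal.tendsto_nhds_zero.1 t1 _ hε', ENNReal.tendsto_nhds_zero.1 t2 _ hε',
      ENNReal.tendsto_nhds_zero.1 hV0 _ hε', hN.tendsto_atTop.eventually_ge_atTop N₀]
      with a h1 h2 h3 h4
    have hNa : (0 : ℝ) < N a := by exact_mod_cast hNpos a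
    have hb := lintegral_enorm_sub_le (ℓ := ℓ) (hX a) (hVm a) (K := m * N a) (by positivity) (hV a)
      (hXV a) hε.le (by simpa only [mul_assoc] using hup a)
    have h5 : ENNReal.ofReal |ℓ| * P {ω | X a ω < ℓ - ε} ≤ ENNReal.ofReal ε :=
      (mul_le_mul_right (h a h4) _).trans h2
    calc _ ≤ _ := hb
      _ ≤ ENNReal.ofReal ε + ENNReal.ofReal ε + ENNReal.ofReal ε + ENNReal.ofReal ε := by gcongr
      _ = ENNReal.ofReal (4 * ε) := by
        rw [← ENNReal.ofReal_add hε.le hε.le, ← ENNReal.ofReal_add (by positivity) hε.le,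
          ← ENNReal.ofReal_add (by positivity) hε.le]
        congr 1; ring
  rw [ENNReal.tendsto_nhds_zero]
  intro e he
  rcases eq_or_ne e ⊤ with rfl | hetop
  · exact Eventually.of_forall fun _ => le_top
  · have he' : 0 < e.toReal := ENNReal.toReal_pos he.ne' hetop
    filter_upwards [hbound (e.toReal / 4) (by positivity)] with a ha
    rwa [mul_div_cancel₀ _ four_ne_zero, ENNReal.ofReal_toReal hetop] at ha

end Convergence

/-! ### Control of the negative part of the free energy. -/

variable {n N : ℕ}

/-- The free energy is bounded below by the energy of the constant configuration. -/
lemma neg_le_freeEnergy (hN : 0 < N) {β h : ℝ} (hβ : 0 < β) (hh : 0 ≤ h) (u : Config N → ℝ) :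
    -(β / √(N : ℝ) * |u 1|) ≤ freeEnergy β h u := by
  have hN' : (0 : ℝ) < N := by exact_mod_cast hN
  have hs : 0 < √(N : ℝ) := Real.sqrt_pos.2 hN'
  have h1 : Real.exp (β * √(N : ℝ) * hamiltonian h u 1) ≤ partitionFunction β h u :=
    Finset.single_le_sum (f := fun σ => Real.exp (β * √(N : ℝ) * hamiltonian h u σ))
      (fun σ _ => (Real.exp_pos _).le) (Finset.mem_univ 1)
  rw [← exp_mul_freeEnergy hN, Real.exp_le_exp] at h1
  -- The configuration `1` has all spins plus, so its field energy is nonnegative when h ≥ 0.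
  have h2 : u 1 ≤ hamiltonian h u 1 := by
    rw [hamiltonian]
    have : 0 ≤ ∑ i : Fin N, spin (1 : Config N) i := Finset.sum_nonneg fun i _ => by simp [spin]
    have := mul_nonneg (div_nonneg hh hs.le) this
    linarith
  have h3 : -|u 1| ≤ hamiltonian h u 1 := (neg_abs_le _).trans h2
  have h4 := (mul_le_mul_of_nonneg_left h3 (mul_pos hβ hs).le).trans h1
  rw [← mul_le_mul_iff_right₀ hN']
  refine le_trans (le_of_eq ?_) h4
  have h5 := Real.mul_self_sqrt hN'.le
  field_simp
  linear_combination (|u 1|) * h5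

namespace IsGREM

variable {r : OrderParameter n} {Ω : Type*} [MeasurableSpace Ω] {P : Measure Ω}
  {Y : Config N → Ω → ℝ} (hY : IsGREM r N P Y)

include hY

lemma aemeasurable (σ : Config N) : AEMeasurable (Y σ) P := hY.gaussian.aemeasurable σ

lemma aemeasurable_pi : AEMeasurable (fun ω σ => Y σ ω) P :=
  aemeasurable_pi_lambda _ fun σ => hY.gaussian.aemeasurable σ

lemma aemeasurable_freeEnergy (β h : ℝ) :
    AEMeasurable (fun ω => freeEnergy β h fun σ => Y σ ω) P :=
  (measurable_freeEnergy β h).comp_aemeasurable hY.aemeasurable_pi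

/-- From |y| ≤ 1 + y² and variance at most ϱ ≤ 1; uniform in N, so the lower bound V of order
N^{-1/2} vanishes in L¹. -/
lemma lintegral_abs_le (σ : Config N) : ∫⁻ ω, ENNReal.ofReal |Y σ ω| ∂P ≤ 2 := by
  have hprob := hY.gaussian.isProbabilityMeasure
  have hint : Integrable (fun ω => Y σ ω * Y σ ω) P :=
    ((hY.gaussian.hasGaussianLaw_eval σ).memLp_two.integrable_mul
      (hY.gaussian.hasGaussianLaw_eval σ).memLp_two)
  have h2 : ∫ ω, Y σ ω * Y σ ω ∂P ≤ 1 := by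
    rw [hY.covariance, r.toFun_eq_sum (by unfold lexOverlap; positivity)]
    calc _ ≤ ∑ k ∈ Finset.range n, (r.q (k + 1) - r.q k) := by
          refine Finset.sum_le_sum fun k hk => ?_
          have := sub_pos.2 (r.q_lt k (Finset.mem_range.1 hk))
          split_ifs <;> linarith
      _ = 1 := by rw [Finset.sum_range_sub, r.q_last, r.q_zero, sub_zero]
  calc ∫⁻ ω, ENNReal.ofReal |Y σ ω| ∂P
      ≤ ∫⁻ ω, ENNReal.ofReal (1 + Y σ ω * Y σ ω) ∂P := by
        refine lintegral_mono fun ω => ENNReal.ofReal_le_ofReal ?_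
        rw [← abs_mul_abs_self (Y σ ω)]
        nlinarith [sq_nonneg (|Y σ ω| - 1 / 2)]
    _ = ENNReal.ofReal (∫ ω, (1 + Y σ ω * Y σ ω) ∂P) := by
        have hint' : Integrable (fun ω => 1 + Y σ ω * Y σ ω) P := (integrable_const 1).add hint
        rw [ofReal_integral_eq_lintegral_ofReal hint']
        exact Eventually.of_forall fun ω => by
          simp only [Pi.zero_apply]
          nlinarith [mul_self_nonneg (Y σ ω)]
    _ ≤ ENNReal.ofReal 2 := by
        refine ENNReal.ofReal_le_ofReal ?_
        rw [integral_add (integrable_const 1) hint]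
        simp only [integral_const, probReal_univ, smul_eq_mul, mul_one]
        linarith
    _ = 2 := by norm_num

end IsGREM

end GREM

end

/-! ### Assembly of the deviation bounds. -/

theorem mainTheorem3 {n : ℕ} (r : GREM.OrderParameter n)
    (N : ℕ → ℕ) (hN_mono : StrictMono N) (hN_pos : ∀ a, 0 < N a)
    (hN_int : ∀ a, ∀ k ≤ n, ∃ c : ℕ, r.x k * (N a : ℝ) = (c : ℝ))
    {Ω : Type*} [MeasurableSpace Ω] (P : Measure Ω) [IsProbabilityMeasure P]
    (Y : (a : ℕ) → GREM.Config (N a) → Ω → ℝ)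
    (hY : ∀ a, GREM.IsGREM r (N a) P (Y a))
    (β h : ℝ) (hβ : 0 < β) (hh : 0 ≤ h) :
    (∀ᵐ ω ∂P, Tendsto (fun a => GREM.freeEnergy β h (fun σ => Y a σ ω)) atTop
      (𝓝 (r.limitFreeEnergy β h))) ∧
    (∀ a, MemLp (fun ω => GREM.freeEnergy β h (fun σ => Y a σ ω)) 1 P) ∧
    Tendsto (fun a => eLpNorm
      (fun ω => GREM.freeEnergy β h (fun σ => Y a σ ω) - r.limitFreeEnergy β h) 1 P)
      atTop (𝓝 0) := by
  have hn := r.pos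
  obtain ⟨b, hb, hmono, hfeas, hU, hLow⟩ := r.exists_levelBeta hh hβ
  have hlev : ∀ a, ∃ L : ℕ → ℕ, ∀ k ≤ n, r.x k * (N a : ℝ) = L k := by
    intro a
    have : ∀ k, ∃ c : ℕ, k ≤ n → r.x k * (N a : ℝ) = c := by
      intro k
      by_cases hk : k ≤ n
      · obtain ⟨c, hc⟩ := hN_int a k hk
        exact ⟨c, fun _ => hc⟩
      · exact ⟨0, fun hk' => absurd hk' hk⟩
    choose L hL using this
    exact ⟨L, hL⟩
  choose L hL using hlev
  set ℓ := r.limitFreeEnergy β h with hℓ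
  set X : ℕ → Ω → ℝ := fun a ω => GREM.freeEnergy β h fun σ => Y a σ ω with hXdef
  set V : ℕ → Ω → ℝ := fun a ω => β / √(N a : ℝ) * |Y a 1 ω| with hVdef
  have hX : ∀ a, AEMeasurable (X a) P := fun a => (hY a).aemeasurable_freeEnergy β h
  have hVm : ∀ a, AEMeasurable (V a) P := fun a =>
    ((hY a).aemeasurable 1).abs.const_mul _
  have hm : 0 < b 0 / β := div_pos (hb 0 hn).1 hβ
  have hV : ∀ a ω, 0 ≤ V a ω := fun a ω => by rw [hVdef]; positivity
  have hXV : ∀ a ω, -V a ω ≤ X a ω := fun a ω =>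
    GREM.neg_le_freeEnergy (hN_pos a) hβ hh fun σ => Y a σ ω
  have hVle : ∀ a, ∫⁻ ω, ENNReal.ofReal (V a ω) ∂P ≤ ENNReal.ofReal (β / √(N a : ℝ) * 2) := by
    intro a
    have h0 : 0 ≤ β / √(N a : ℝ) := by positivity
    simp only [hVdef]
    simp_rw [ENNReal.ofReal_mul h0]
    rw [lintegral_const_mul'' _ ((hY a).aemeasurable 1).abs.ennreal_ofReal]
    gcongr
    simpa using (hY a).lintegral_abs_le 1
  have hV0 : Tendsto (fun a => ∫⁻ ω, ENNReal.ofReal (V a ω) ∂P) atTop (𝓝 0) := by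
    refine tendsto_of_tendsto_of_tendsto_of_le_of_le tendsto_const_nhds ?_ (fun a => zero_le) hVle
    have h1 : Tendsto (fun a => √(N a : ℝ)) atTop atTop :=
      Real.tendsto_sqrt_atTop.comp (tendsto_natCast_atTop_atTop.comp hN_mono.tendsto_atTop)
    have h2 := (h1.const_div_atTop β).mul_const 2
    rw [zero_mul] at h2
    simpa using ENNReal.tendsto_ofReal h2
  have hup : ∀ a, ∫⁻ ω, ENNReal.ofReal (Real.exp (b 0 / β * (N a * (X a ω - ℓ)))) ∂P ≤ 1 := by
    intro a
    have h1 := GREM.lintegral_exp_freeEnergy_le (h := h) r hβ hb hmono (hN_pos a) (hL a)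
    rw [hU] at h1
    have hmeas : Measurable fun u : GREM.Config (N a) → ℝ =>
        ENNReal.ofReal (Real.exp (b 0 / β * (N a * (GREM.freeEnergy β h u - ℓ)))) := by
      have := GREM.measurable_freeEnergy (N := N a) β h
      fun_prop
    -- The moment bound involves only the law of the field at this N, so it passes from the tree to
    -- Y.
    rw [← lintegral_map hmeas (GREM.measurable_treeField r (L a)),
      ← (hY a).map_eq (hN_pos a) (hL a),
      lintegral_map' hmeas.aemeasurable (hY a).aemeasurable_pi] at h1
    exact h1
  have hlow : ∀ ε > 0, ∃ C κ : ℝ, 0 < κ ∧ ∃ N₀ : ℕ, ∀ a, N₀ ≤ N a →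
      P {ω | X a ω < ℓ - ε} ≤ ENNReal.ofReal (C * Real.exp (-(κ * N a))) := by
    intro ε hε
    obtain ⟨C, κ, hκ, N₀, h1⟩ := GREM.exists_measure_freeEnergy_lt_le r hβ hh
      (fun k hk => (hb k hk).1) hfeas hε
    refine ⟨C, κ, hκ, N₀, fun a ha => ?_⟩
    have h2 := h1 (N a) ha (L a) (hL a)
    rw [hLow] at h2
    have hset : MeasurableSet {u : GREM.Config (N a) → ℝ | GREM.freeEnergy β h u < ℓ - ε} :=
      measurableSet_lt (GREM.measurable_freeEnergy β h) measurable_const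
    have h3 := Measure.map_apply (μ := GREM.vertexMeasure n (N a))
      (GREM.measurable_treeField r (L a)) hset
    rw [← (hY a).map_eq (hN_pos a) (hL a),
      Measure.map_apply_of_aemeasurable (hY a).aemeasurable_pi hset] at h3
    exact h3.trans_le h2
  refine ⟨GREM.ae_tendsto_of_exp_bounds hN_mono hX hm hup hlow, fun a => ?_, ?_⟩
  · have hNa : (0 : ℝ) < N a := by exact_mod_cast hN_pos a
    have h1 := GREM.lintegral_enorm_sub_le (ℓ := ℓ) (hX a) (hVm a) (K := b 0 / β * N a)
      (by positivity) (hV a) (hXV a) zero_le_one (by simpa only [mul_assoc] using hup a)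
    have h2 : MemLp (fun ω => X a ω - ℓ) 1 P := by
      refine ⟨((hX a).sub_const ℓ).aestronglyMeasurable, ?_⟩
      rw [eLpNorm_one_eq_lintegral_enorm]
      refine h1.trans_lt ?_
      have := (hVle a).trans_lt ENNReal.ofReal_lt_top
      finiteness
    have h3 := h2.add (memLp_const ℓ)
    refine h3.ae_eq (Eventually.of_forall fun ω => ?_)
    simp [hXdef]
  · simp_rw [eLpNorm_one_eq_lintegral_enorm]
    exact GREM.tendsto_lintegral_enorm_sub_of_exp_bounds hN_mono hN_pos hX hVm hm hV hXV hV0 hup hlow
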